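/- **Setting.** For $\epsilon>0$ let $\phi(x,y)=e^{-\epsilon^2(x-y)^2}$. Let $x_0\in\mathbb R$, $h>0$, $x_i=x_0+ih$. For finite symmetric index sets $S\ni 0$ and $M\not\ni0$ consider formulas $u'(x_0)\approx\sum_{i\in S}\alpha_i u(x_i)+\sum_{k\in M}\beta_k u'(x_k)$. The Gaussian RBF-HFD (compact, Hermite) weights solve the collocation system, with unknowns $\alpha_i$, $\beta_k$ and an auxiliary $\gamma$, $$\sum_{i\in S}\alpha_i\phi(x_i,x_j)+\sum_{k\in M}\beta_k\,\partial_x\phi(x_k,x_j)+\gamma=\partial_x\phi(x_0,x_j)\quad(j\in S),$$ $$\sum_{i\in S}\alpha_i\,\partial_y\phi(x_i,x_l)+\sum_{k\in M}\beta_k\,\partial_x\partial_y\phi(x_k,x_l)=\partial_x\partial_y\phi(x_0,x_l)\quad(l\in M),\qquad \sum_{i\in S}\alpha_i=0 .$$ The *reduced system* is obtained by imposing $\alpha_{-i}=-\alpha_i$ ($i\ne0$), $\beta_{-k}=\beta_k$ and keeping only the equations with $j\le 0$ and $l<0$ (and $\sum\alpha_i=0$). The local truncation error is $\tau_0=\sum_{i\in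 S}\alpha_iu(x_i)+\sum_{k\in M}\beta_ku'(x_k)-u'(x_0)$. The formulas are: order 6, $S=\{-2,\dots,2\}$, $M=\{\pm1\}$; order 8, $S=\{-2,\dots,2\}$, $M=\{\pm1,\pm2\}$; order 10, $S=\{-3,\dots,3\}$, $M=\{\pm1,\pm2\}$. The symbols $O(\epsilon^8h^7)$, $O(\epsilon^8h^8)$ mean bounds, uniform in $\epsilon,h>0$ with $\epsilon h$ sufficiently small. The symbol $O(h^{2n+2}P_{n+1}(\epsilon^2))$ means a bound by $h^{2n+2}P(\epsilon^2)$, with a polynomial $P$ of degree at most $n+1$ depending only on $u$ and $x_0$, uniform in $\epsilon,h>0$ with $\epsilon h<\delta$ ($\delta$ independent of $u$, $x_0$) and $h<h_0(u,x_0)$. In the formula of order $2n$, $u$ is any function of class $C^{2n+3}$ near $x_0$, and all derivatives of $u$ below are taken at $x_0$. **Claim.** For each of the three formulas and all $\epsilon,h>0$ and $x_0$, the collocation system and the reduced system have one and the same unique solution, which does not depend on $x_0$; it satisfies $\alpha_{-i}=-\alpha_i$, $\alpha_0=0$, $\beta_{-k}=\beta_k$, $\gamma=0$. Moreover: *Order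 6.* $\alpha_{-2}=-\frac1{36h}-\frac{\epsilon^2h}{9}-\frac{10\epsilon^4h^3}{63}-\frac{8\epsilon^6h^5}{189}+O(\epsilon^8h^7)$, $\alpha_{-1}=-\frac7{9h}-\frac{\epsilon^2h}{9}+\frac{43\epsilon^4h^3}{126}-\frac{43\epsilon^6h^5}{378}+O(\epsilon^8h^7)$, $\beta_{-1}=-\frac13-\frac{\epsilon^2h^2}{3}+\frac{\epsilon^4h^4}{42}+\frac{17\epsilon^6h^6}{126}+O(\epsilon^8h^8)$, $$\tau_0=\tfrac{h^6}{1260}\left(840\epsilon^6u'+420\epsilon^4u^{(3)}+42\epsilon^2u^{(5)}+u^{(7)}\right)+O(h^8P_4(\epsilon^2)).$$ *Order 8.* $\alpha_{-2}=-\frac{25}{216h}-\frac{19\epsilon^2h}{54}-\frac{139\epsilon^4h^3}{486}+\frac{46\epsilon^6h^5}{243}+O(\epsilon^8h^7)$, $\alpha_{-1}=-\frac{20}{27h}+\frac{4\epsilon^2h}{27}+\frac{106\epsilon^4h^3}{243}-\frac{62\epsilon^6h^5}{243}+O(\epsilon^8h^7)$, $\beta_{-2}=-\frac1{36}-\frac{\epsilon^2h^2}{9}-\frac{13\epsilon^4h^4}{81}-\frac{4\epsilon^6h^6}{81}+O(\epsilon^8h^8)$,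 $\beta_{-1}=-\frac49-\frac{4\epsilon^2h^2}{9}+\frac{2\epsilon^4h^4}{81}+\frac{14\epsilon^6h^6}{81}+O(\epsilon^8h^8)$, $$\tau_0=h^8\left(-\tfrac23\epsilon^8u'-\tfrac49\epsilon^6u^{(3)}-\tfrac1{15}\epsilon^4u^{(5)}-\tfrac1{315}\epsilon^2u^{(7)}-\tfrac1{22680}u^{(9)}\right)+O(h^{10}P_5(\epsilon^2)).$$ *Order 10.* $\alpha_{-3}=-\frac1{600h}-\frac{3\epsilon^2h}{200}-\frac{1257\epsilon^4h^3}{22000}-\frac{2403\epsilon^6h^5}{22000}+O(\epsilon^8h^7)$, $\alpha_{-2}=-\frac{101}{600h}-\frac{71\epsilon^2h}{150}-\frac{302\epsilon^4h^3}{1375}+\frac{6928\epsilon^6h^5}{12375}+O(\epsilon^8h^7)$, $\alpha_{-1}=-\frac{17}{24h}+\frac{7\epsilon^2h}{24}+\frac{391\epsilon^4h^3}{880}-\frac{4043\epsilon^6h^5}{7920}+O(\epsilon^8h^7)$, $\beta_{-2}=-\frac1{20}-\frac{\epsilon^2h^2}{5}-\frac{72\epsilon^4h^4}{275}+\frac{16\epsilon^6h^6}{825}+O(\epsilon^8h^8)$,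 $\beta_{-1}=-\frac12-\frac{\epsilon^2h^2}{2}+\frac{21\epsilon^4h^4}{220}+\frac{173\epsilon^6h^6}{660}+O(\epsilon^8h^8)$, $$\tau_0=h^{10}\left(\tfrac65\epsilon^{10}u'+\epsilon^8u^{(3)}+\tfrac{55440}{277200}\epsilon^6u^{(5)}+\tfrac{3960}{277200}\epsilon^4u^{(7)}+\tfrac{110}{277200}\epsilon^2u^{(9)}+\tfrac1{277200}u^{(11)}\right)+O(h^{12}P_6(\epsilon^2)).$$ *Order 10, truncated system.* Replace every kernel entry of the reduced order-10 system by its Taylor polynomial in $h$ at $0$ of degree $20$. For $\epsilon h>0$ sufficiently small this system has a unique solution, which does not depend on $x_0$; it satisfies $\alpha_{-i}=-\alpha_i$, $\alpha_0=0$, $\beta_{-k}=\beta_k$, $\gamma=0$ and $\alpha_{-3}=-\frac1{600h}-\frac{3\epsilon^2h}{200}+\frac{7639616774597\,\epsilon^4h^3}{58982400000}+\frac{6690462911023\,\epsilon^6h^5}{3276800000}+O(\epsilon^8h^7)$, $\alpha_{-2}=-\frac{101}{600h}-\frac{71\epsilon^2h}{150}+\frac{542622915796387\,\epsilon^4h^3}{132710400000}+\frac{4920524576353819\,\epsilon^6h^5}{132710400000}+O(\epsilon^8h^7)$,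 $\alpha_{-1}=-\frac{17}{24h}+\frac{7\epsilon^2h}{24}-\frac{53491473198179\,\epsilon^4h^3}{21233664000}-\frac{299239342744897\,\epsilon^6h^5}{10616832000}+O(\epsilon^8h^7)$, $\beta_{-2}=-\frac1{20}-\frac{\epsilon^2h^2}{5}+\frac{7641828614597\,\epsilon^4h^4}{4423680000}+\frac{82219926605429\,\epsilon^6h^6}{4423680000}+O(\epsilon^8h^8)$, $\beta_{-1}=-\frac12-\frac{\epsilon^2h^2}{2}+\frac{7643155718597\,\epsilon^4h^4}{1769472000}+\frac{29645672092819\,\epsilon^6h^6}{884736000}+O(\epsilon^8h^8)$, and $\tau_0$ has the same leading term and the same form of remainder as for the order-10 formula above. *Flat limits.* For fixed $h>0$ and $\epsilon\to0^+$ the weights converge to the classical compact finite difference weights: order 6, $\alpha_{-2}\to-\frac1{36h}$, $\alpha_{-1}\to-\frac7{9h}$, $\beta_{-1}\to-\frac13$; order 8, $\alpha_{-2}\to-\frac{25}{216h}$, $\alpha_{-1}\to-\frac{20}{27h}$, $\beta_{-2}\to-\frac1{36}$, $\beta_{-1}\to-\frac49$; order 10 (both systems), $\alpha_{-3}\to-\frac1{600h}$,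 $\alpha_{-2}\to-\frac{101}{600h}$, $\alpha_{-1}\to-\frac{17}{24h}$, $\beta_{-2}\to-\frac1{20}$, $\beta_{-1}\to-\frac12$. -/

import Mathlib

open Filter Topology

noncomputable section

namespace RBFHFD

/-- The Gaussian radial function `φ(x, y) = exp (-ε² (x - y)²)` on the line,
with shape parameter `ε`; `y` is the centre. -/
def gaussian (ε x y : ℝ) : ℝ := Real.exp (-(ε ^ 2 * (x - y) ^ 2))

/-- `d/dx` applied to the evaluation point of the kernel. -/
def gaussianD₁ (ε x y : ℝ) : ℝ := deriv (fun s => gaussian ε s y) x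

/-- `d/dy` applied to the centre of the kernel. -/
def gaussianD₂ (ε x y : ℝ) : ℝ := deriv (fun s => gaussian ε x s) y

/-- `d/dx` and `d/dy` applied to both arguments of the kernel. -/
def gaussianD₁₂ (ε x y : ℝ) : ℝ := deriv (fun s => gaussianD₂ ε s y) x

/-- The uniform nodes `x_i = x₀ + i h`. -/
def node (x₀ h : ℝ) (i : ℤ) : ℝ := x₀ + i * h

/-- The four families of entries of a Hermite collocation matrix for `d/dx`.
The first index is the evaluation node, the second one is the centre. -/
structure Entries where
  /-- entries of `Φ` -/
  φ : ℤ → ℤ → ℝ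
  /-- entries of `L¹Φ` (derivative in the evaluation point) -/
  φ₁ : ℤ → ℤ → ℝ
  /-- entries of `L²Φ` (derivative in the centre) -/
  φ₂ : ℤ → ℤ → ℝ
  /-- entries of `L¹L²Φ` -/
  φ₁₂ : ℤ → ℤ → ℝ

/-- The entries for the Gaussian on the nodes `x₀ + i h`. -/
def gaussianEntries (ε x₀ h : ℝ) : Entries where
  φ i j := gaussian ε (node x₀ h i) (node x₀ h j)
  φ₁ i j := gaussianD₁ ε (node x₀ h i) (node x₀ h j)
  φ₂ i j := gaussianD₂ ε (node x₀ h i) (node x₀ h j)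
  φ₁₂ i j := gaussianD₁₂ ε (node x₀ h i) (node x₀ h j)

/-- The Taylor polynomial of `f` at `0`, of degree `N`, evaluated at `h`. -/
def taylorPoly (N : ℕ) (f : ℝ → ℝ) (h : ℝ) : ℝ :=
  ∑ k ∈ Finset.range (N + 1), iteratedDeriv k f 0 / (k.factorial : ℝ) * h ^ k

/-- The Gaussian entries, each of them replaced with its Taylor polynomial in `h` up to `h ^ N`. -/
def truncatedEntries (N : ℕ) (ε x₀ h : ℝ) : Entries where
  φ i j := taylorPoly N (fun s => (gaussianEntries ε x₀ s).φ i j) h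
  φ₁ i j := taylorPoly N (fun s => (gaussianEntries ε x₀ s).φ₁ i j) h
  φ₂ i j := taylorPoly N (fun s => (gaussianEntries ε x₀ s).φ₂ i j) h
  φ₁₂ i j := taylorPoly N (fun s => (gaussianEntries ε x₀ s).φ₁₂ i j) h

/-- Weights of a formula `u'(x₀) ≈ ∑ α_i u(x_i) + ∑ β_k u'(x_k)`, together with the coefficient
`γ` that belongs to the constant polynomial in the collocation system. -/
structure Weights where
  α : ℤ → ℝ
  β : ℤ → ℝ
  γ : ℝ

/-- `w` solves the full Hermite collocation system, augmented with constants, for `u'(x₀)`: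
function values are used at the nodes with index in `S`, derivative values at the nodes with
index in `M`. -/
structure IsWeights (E : Entries) (S M : Finset ℤ) (w : Weights) : Prop where
  supp_α : ∀ i, i ∉ S → w.α i = 0
  supp_β : ∀ k, k ∉ M → w.β k = 0
  eq_val : ∀ j ∈ S,
    ∑ i ∈ S, w.α i * E.φ i j + ∑ k ∈ M, w.β k * E.φ₁ k j + w.γ = E.φ₁ 0 j
  eq_der : ∀ l ∈ M,
    ∑ i ∈ S, w.α i * E.φ₂ i l + ∑ k ∈ M, w.β k * E.φ₁₂ k l = E.φ₁₂ 0 l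
  eq_const : ∑ i ∈ S, w.α i = 0

/-- `w` solves the reduced system: the formula has the central form
`∑_{i < 0} α_i (u_i - u_{-i}) + α_0 u_0 + ∑_{k < 0} β_k (u'_k + u'_{-k})`, and it is collocated
only at the centres with index `j ≤ 0` (values) and `l < 0` (derivatives). -/
structure IsReducedWeights (E : Entries) (S M : Finset ℤ) (w : Weights) : Prop where
  supp_α : ∀ i, i ∉ S → w.α i = 0
  supp_β : ∀ k, k ∉ M → w.β k = 0
  odd_α : ∀ i, i ≠ 0 → w.α (-i) = -w.α i
  even_β : ∀ k, w.β (-k) = w.β k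
  eq_val : ∀ j ∈ S, j ≤ 0 →
    ∑ i ∈ S, w.α i * E.φ i j + ∑ k ∈ M, w.β k * E.φ₁ k j + w.γ = E.φ₁ 0 j
  eq_der : ∀ l ∈ M, l < 0 →
    ∑ i ∈ S, w.α i * E.φ₂ i l + ∑ k ∈ M, w.β k * E.φ₁₂ k l = E.φ₁₂ 0 l
  eq_const : ∑ i ∈ S, w.α i = 0

/-- For all `ε, h > 0` and all `x₀`, `w ε h` is the only solution of the full collocation system
of the Gaussian and the only solution of the reduced one. -/
def AreGaussianWeights (S M : Finset ℤ) (w : ℝ → ℝ → Weights) : Prop :=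
  ∀ ε h : ℝ, 0 < ε → 0 < h → ∀ (x₀ : ℝ) (v : Weights),
    (IsWeights (gaussianEntries ε x₀ h) S M v ↔ v = w ε h) ∧
    (IsReducedWeights (gaussianEntries ε x₀ h) S M v ↔ v = w ε h)

/-- For all sufficiently small `ε h > 0` and all `x₀`, `w ε h` is the only solution of the
reduced system whose entries are truncated at `h ^ N`. -/
def AreTruncatedWeights (N : ℕ) (S M : Finset ℤ) (w : ℝ → ℝ → Weights) : Prop :=
  ∃ δ : ℝ, 0 < δ ∧ ∀ ε h : ℝ, 0 < ε → 0 < h → ε * h < δ → ∀ (x₀ : ℝ) (v : Weights),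
    IsReducedWeights (truncatedEntries N ε x₀ h) S M v ↔ v = w ε h

/-- Central symmetry: `α_{-i} = -α_i` (hence `α_0 = 0`), `β_{-k} = β_k`. -/
def IsCentral (w : Weights) : Prop :=
  (∀ i, w.α (-i) = -w.α i) ∧ w.α 0 = 0 ∧ (∀ k, w.β (-k) = w.β k) ∧ w.γ = 0

/-- `a = c₀/h + c₁ ε² h + c₂ ε⁴ h³ + c₃ ε⁶ h⁵ + O(ε⁸ h⁷)` for `ε h → 0`. -/
def AlphaExpansion (a : ℝ → ℝ → ℝ) (c₀ c₁ c₂ c₃ : ℝ) : Prop :=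
  ∃ C δ : ℝ, 0 < δ ∧ ∀ ε h : ℝ, 0 < ε → 0 < h → ε * h < δ →
    |a ε h - (c₀ / h + c₁ * ε ^ 2 * h + c₂ * ε ^ 4 * h ^ 3 + c₃ * ε ^ 6 * h ^ 5)|
      ≤ C * (ε ^ 8 * h ^ 7)

/-- `b = c₀ + c₁ ε² h² + c₂ ε⁴ h⁴ + c₃ ε⁶ h⁶ + O(ε⁸ h⁸)` for `ε h → 0`. -/
def BetaExpansion (b : ℝ → ℝ → ℝ) (c₀ c₁ c₂ c₃ : ℝ) : Prop :=
  ∃ C δ : ℝ, 0 < δ ∧ ∀ ε h : ℝ, 0 < ε → 0 < h → ε * h < δ →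
    |b ε h - (c₀ + c₁ * ε ^ 2 * h ^ 2 + c₂ * ε ^ 4 * h ^ 4 + c₃ * ε ^ 6 * h ^ 6)|
      ≤ C * (ε ^ 8 * h ^ 8)

/-- The flat limit: for every fixed `h > 0`, `f ε h → c h` as `ε → 0+`. -/
def FlatLimit (f : ℝ → ℝ → ℝ) (c : ℝ → ℝ) : Prop :=
  ∀ h : ℝ, 0 < h → Tendsto (fun ε => f ε h) (𝓝[>] 0) (𝓝 (c h))

/-- The local truncation error `τ₀` of the formula with weights `w`, for `u` at `x₀`. -/
def lte (S M : Finset ℤ) (w : Weights) (u : ℝ → ℝ) (x₀ h : ℝ) : ℝ :=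
  ∑ i ∈ S, w.α i * u (node x₀ h i) + ∑ k ∈ M, w.β k * deriv u (node x₀ h k) - deriv u x₀

/-- `τ₀ = h^{2n} Q(ε, u^{(·)}(x₀)) + O(h^{2n+2} P_{n+1}(ε²))` for `ε h ≪ 1` and every `u` that is
`2n+3` times continuously differentiable near `x₀`. Here `P_{n+1}` is a polynomial of degree at
most `n+1` that depends on `u` and `x₀` only; the bound holds uniformly in `ε` and `h`. The second
argument of `Q` stands for the sequence `k ↦ u^{(k)}(x₀)`. -/
def HasLTE (S M : Finset ℤ) (w : ℝ → ℝ → Weights) (n : ℕ) (Q : ℝ → (ℕ → ℝ) → ℝ) : Prop :=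
  ∃ δ : ℝ, 0 < δ ∧ ∀ (u : ℝ → ℝ) (x₀ : ℝ), ContDiffAt ℝ ((2 * n + 3 : ℕ) : WithTop ℕ∞) u x₀ →
    ∃ P : Polynomial ℝ, P.natDegree ≤ n + 1 ∧ ∃ h₀ : ℝ, 0 < h₀ ∧
      ∀ ε h : ℝ, 0 < ε → 0 < h → h < h₀ → ε * h < δ →
        |lte S M (w ε h) u x₀ h - h ^ (2 * n) * Q ε (fun k => iteratedDeriv k u x₀)|
          ≤ h ^ (2 * n + 2) * P.eval (ε ^ 2)

/-- Nodes with function values, sixth and eighth order: `-2, …, 2`. -/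
def nodes5 : Finset ℤ := {-2, -1, 0, 1, 2}

/-- Nodes with function values, tenth order: `-3, …, 3`. -/
def nodes7 : Finset ℤ := {-3, -2, -1, 0, 1, 2, 3}

/-- Nodes with derivative values, sixth order. -/
def derNodes2 : Finset ℤ := {-1, 1}

/-- Nodes with derivative values, eighth and tenth order. -/
def derNodes4 : Finset ℤ := {-2, -1, 1, 2}

end RBFHFD

end

open RBFHFD

/-! ### Asymptotic expansions in one small positive variable. -/

namespace RBFHFD

open Asymptotics Matrix

/-! Put `s = (εh)²`. For centrally symmetric weights, with scaled unknowns `v = (h α_{-i}, β_{-k})`,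
the reduced system becomes a square system whose matrix `collocation` depends on `s` alone. There
are `n = m + r` unknowns in the formula of order `2n`.

Solvability for every `s > 0`: since `exp(-s(x-y)²) = e^{-sx²} e^{-sy²} ∑ (2s)^N x^N y^N / N!`, the
quadratic form of the Gaussian on combinations of `δ_i` and `δ'_i` is a positively weighted sum of
squares of moments. It vanishes only if all moments do, and Hermite interpolation then kills the
combination (`eq_zero_of_gaussian_form_eq_zero`). The auxiliary `γ` drops out of the form because `∑
α_i = 0`. Reflection shows that the symmetric solution also satisfies the collocation equations left
out of the reduced system.

Expansions: the matrix vanishes at `s = 0`, so it has to be rescaled. In the coordinates given by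
the values of the formula on `x, x³, …, x^{2n-1}`, its entry `(q, p)` is `κ_{qp} s^{p+q+1} +
O(s^{p+q+2})`, because the power `s^k` of the kernel carries the monomials of total degree `2k`.
Removing these powers leaves a matrix with an invertible limit `κ`, a rescaled Gram matrix of odd
monomials. Hence a polynomial candidate whose residual is `O(s^{N+q+1})` in row `q` differs from the
solution by `O(s^{N-p})` in the `p`-th moment (`isBigO_moment_sub`). With `N = n + 3` the hypotheses
become finitely many rational identities (`IsFormalSolution`), checked by evaluation. The truncated
system uses the same argument with truncated coefficients; its solvability for small `εh` also comes
from the invertible limit.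

Truncation error: Taylor's formula gives `τ₀` as a sum over `p ≤ n` of `u^{(2p+1)} h^{2p}` times the
`p`-th moment error, divided by `(2p+1)!`, plus a remainder. These moment errors are `q_p s^{n-p} +
O(s^{n-p+1})`, so every term contributes at order `h^{2n}` (`hasLTE_of_moments`). Flat limits are
read off the expansions. -/

/-- `f s = ∑_{k < N} c k s ^ k + O(s ^ N)` as `s → 0+`. -/
def HasExpansion (f : ℝ → ℝ) (c : ℕ → ℝ) (N : ℕ) : Prop :=
  (fun s => f s - ∑ k ∈ Finset.range N, c k * s ^ k) =O[𝓝[>] (0 : ℝ)] (fun s => s ^ N)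

theorem pow_isBigO_pow {a b : ℕ} (hab : a ≤ b) :
    (fun s : ℝ => s ^ b) =O[𝓝[>] (0 : ℝ)] (fun s => s ^ a) := by
  refine IsBigO.of_bound 1 ?_
  filter_upwards [Ioo_mem_nhdsGT (zero_lt_one' ℝ)] with s hs
  rw [one_mul, norm_pow, norm_pow, Real.norm_of_nonneg hs.1.le]
  exact pow_le_pow_of_le_one hs.1.le hs.2.le hab

namespace HasExpansion

variable {f g : ℝ → ℝ} {c d : ℕ → ℝ} {N : ℕ}

theorem congr_coeff (hf : HasExpansion f c N) (h : ∀ k < N, c k = d k) : HasExpansion f d N := by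
  unfold HasExpansion at *
  convert hf using 3 with s
  exact Finset.sum_congr rfl fun k hk => by rw [h k (Finset.mem_range.1 hk)]

theorem add (hf : HasExpansion f c N) (hg : HasExpansion g d N) :
    HasExpansion (fun s => f s + g s) (fun k => c k + d k) N := by
  unfold HasExpansion at *
  refine (IsBigO.add hf hg).congr_left fun s => ?_
  simp only [add_mul, Finset.sum_add_distrib]; ring

theorem const_mul (a : ℝ) (hf : HasExpansion f c N) :
    HasExpansion (fun s => a * f s) (fun k => a * c k) N := by
  unfold HasExpansion at *
  refine (IsBigO.const_mul_left hf a).congr_left fun s => ?_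
  simp only [mul_assoc, ← Finset.mul_sum]; ring

theorem mul_const (a : ℝ) (hf : HasExpansion f c N) :
    HasExpansion (fun s => f s * a) (fun k => c k * a) N := by
  simpa only [mul_comm _ a] using hf.const_mul a

theorem neg (hf : HasExpansion f c N) : HasExpansion (fun s => -f s) (fun k => -c k) N := by
  simpa using hf.const_mul (-1)

theorem sub (hf : HasExpansion f c N) (hg : HasExpansion g d N) :
    HasExpansion (fun s => f s - g s) (fun k => c k - d k) N := by
  simpa only [sub_eq_add_neg] using hf.add hg.neg

theorem sum {ι : Type*} {t : Finset ι} {f : ι → ℝ → ℝ} {c : ι → ℕ → ℝ}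
    (h : ∀ i ∈ t, HasExpansion (f i) (c i) N) :
    HasExpansion (fun s => ∑ i ∈ t, f i s) (fun k => ∑ i ∈ t, c i k) N := by
  classical
  induction t using Finset.induction_on with
  | empty => simpa [HasExpansion] using isBigO_zero _ _
  | insert a t ha ih =>
    simp only [Finset.sum_insert ha]
    exact (h a (Finset.mem_insert_self _ _)).add
      (ih fun i hi => h i (Finset.mem_insert_of_mem hi))

/-- Multiplication by `s` gains an order; dropping it again lets all summands of a Cauchy product
share one order `N`. -/
theorem of_succ (hf : HasExpansion f c (N + 1)) : HasExpansion f c N := by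
  unfold HasExpansion at *
  have h1 := hf.trans (pow_isBigO_pow N.le_succ)
  have h2 : (fun s : ℝ => c N * s ^ N) =O[𝓝[>] (0 : ℝ)] (fun s => s ^ N) :=
    (isBigO_refl _ _).const_mul_left _
  refine (h1.add h2).congr_left fun s => ?_
  rw [Finset.sum_range_succ]; ring

theorem id_mul (hf : HasExpansion f c N) :
    HasExpansion (fun s => s * f s) (fun k => if k = 0 then 0 else c (k - 1)) (N + 1) := by
  unfold HasExpansion at *
  have h := (isBigO_refl (fun s : ℝ => s) (𝓝[>] (0 : ℝ))).mul hf
  refine h.congr (fun s => ?_) (fun s => ?_)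
  · rw [Finset.sum_range_succ']
    simp only [Nat.add_eq_zero_iff, one_ne_zero, and_false, if_false, Nat.add_sub_cancel, if_true,
      zero_mul, add_zero, mul_sub, Finset.mul_sum]
    congr 1
    exact Finset.sum_congr rfl fun k _ => by ring
  · ring

theorem pow_mul (m : ℕ) (hf : HasExpansion f c N) :
    HasExpansion (fun s => s ^ m * f s) (fun k => if m ≤ k then c (k - m) else 0) N := by
  induction m with
  | zero => simpa using hf
  | succ m ih =>
    convert ih.id_mul.of_succ using 2 with s k
    · ring
    · rcases k with _ | k <;> simp

theorem of_poly {f : ℝ → ℝ} {c : ℕ → ℝ} {L : ℕ}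
    (hf : ∀ s, 0 < s → f s = ∑ k ∈ Finset.range L, c k * s ^ k)
    (hLN : L ≤ N) (hc : ∀ k, L ≤ k → c k = 0) : HasExpansion f c N := by
  unfold HasExpansion
  refine (isBigO_zero (fun s : ℝ => s ^ N) (𝓝[>] (0 : ℝ))).congr' ?_ EventuallyEq.rfl
  filter_upwards [self_mem_nhdsWithin] with s hs
  rw [hf s hs, eq_comm, sub_eq_zero]
  refine Finset.sum_subset (Finset.range_mono hLN) fun k _ hk => ?_
  rw [hc k (by simpa using hk), zero_mul]

theorem isBigO (hf : HasExpansion f c N) {j : ℕ} (hj : j ≤ N) (hc : ∀ k < j, c k = 0) :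
    f =O[𝓝[>] (0 : ℝ)] (fun s => s ^ j) := by
  have h1 := hf.trans (pow_isBigO_pow hj)
  have h2 : (fun s : ℝ => ∑ k ∈ Finset.range N, c k * s ^ k) =O[𝓝[>] (0 : ℝ)]
      (fun s => s ^ j) := by
    refine IsBigO.fun_sum fun k _ => ?_
    rcases lt_or_ge k j with hk | hk
    · simpa [hc k hk] using isBigO_zero _ _
    · exact (pow_isBigO_pow hk).const_mul_left _
  simpa using h1.add h2

theorem isBigO_sub (hf : HasExpansion f c N) {j : ℕ} (hj : j + 1 ≤ N) (hc : ∀ k < j, c k = 0) :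
    (fun s => f s - c j * s ^ j) =O[𝓝[>] (0 : ℝ)] (fun s => s ^ (j + 1)) := by
  have hp : HasExpansion (fun s => c j * s ^ j) (fun k => if k = j then c j else 0) N := by
    refine of_poly (L := j + 1) (fun s _ => ?_) hj fun k hk => if_neg (by omega)
    rw [Finset.sum_eq_single j] <;> simp +contextual
  refine (hf.sub hp).isBigO hj fun k hk => ?_
  rcases Nat.lt_succ_iff_lt_or_eq.1 hk with h | h
  · simp [hc k h, h.ne]
  · simp [h]

end HasExpansion

/-! ### Linear systems that degenerate at `s = 0` at graded rates. -/

section LinearSystem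

variable {ι : Type*} [Fintype ι] [DecidableEq ι] {n : ℕ}

/-- The matrix `Wᵀ K W`, with row `q` divided by `s ^ (q + 1)` and column `p` by `s ^ p`. -/
noncomputable def rescaled (K : Matrix ι ι ℝ) (W : Matrix ι (Fin n) ℝ) (s : ℝ) :
    Matrix (Fin n) (Fin n) ℝ :=
  Matrix.of fun q p => (Wᵀ * K * W) q p / s ^ ((p : ℕ) + q + 1)

/-- The rescaling is a change of unknowns: `y_p = s^p (U x)_p` absorbs the column powers and `Wᵀ`
followed by division absorbs the row powers. -/
theorem rescaled_mulVec {K : Matrix ι ι ℝ} {W : Matrix ι (Fin n) ℝ} {U : Matrix (Fin n) ι ℝ}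
    (hWU : W * U = 1) {s : ℝ} (hs : s ≠ 0) (x : ι → ℝ) (q : Fin n) :
    (rescaled K W s *ᵥ fun p => s ^ (p : ℕ) * (U *ᵥ x) p) q
      = (Wᵀ *ᵥ (K *ᵥ x)) q / s ^ ((q : ℕ) + 1) := by
  have h : Wᵀ *ᵥ (K *ᵥ x) = (Wᵀ * K * W) *ᵥ (U *ᵥ x) := by
    rw [mulVec_mulVec, mulVec_mulVec, Matrix.mul_assoc _ W U, hWU, Matrix.mul_one]
  rw [h, mulVec, mulVec, dotProduct, dotProduct, Finset.sum_div]
  refine Finset.sum_congr rfl fun p _ => ?_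
  simp only [rescaled, of_apply]
  field_simp
  ring

theorem tendsto_rescaled {ι : Type*} [Fintype ι] {K : ℝ → Matrix ι ι ℝ} {W : Matrix ι (Fin n) ℝ}
    {κ : Matrix (Fin n) (Fin n) ℝ}
    (hK : ∀ q p : Fin n, (fun s => (Wᵀ * K s * W) q p - κ q p * s ^ ((p : ℕ) + q + 1))
      =O[𝓝[>] (0 : ℝ)] (fun s => s ^ ((p : ℕ) + q + 2))) :
    Tendsto (fun s => rescaled (K s) W s) (𝓝[>] (0 : ℝ)) (𝓝 κ) := by
  refine tendsto_pi_nhds.2 fun q => tendsto_pi_nhds.2 fun p => ?_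
  rw [← tendsto_sub_nhds_zero_iff]
  have hid : Tendsto (fun s : ℝ => s) (𝓝[>] (0 : ℝ)) (𝓝 0) := nhdsWithin_le_nhds
  refine IsBigO.trans_tendsto (g'' := fun s : ℝ => s) ?_ hid
  have h := (hK q p).mul (isBigO_refl (fun s : ℝ => (s ^ ((p : ℕ) + q + 1))⁻¹) (𝓝[>] (0 : ℝ)))
  refine h.congr' ?_ ?_
  · filter_upwards [self_mem_nhdsWithin] with s hs
    have hs' : s ≠ 0 := (Set.mem_Ioi.1 hs).ne'
    simp only [rescaled, of_apply]
    field_simp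
  · filter_upwards [self_mem_nhdsWithin] with s hs
    have hs' : s ≠ 0 := (Set.mem_Ioi.1 hs).ne'
    field_simp
    ring

variable {K : ℝ → Matrix ι ι ℝ} {W : Matrix ι (Fin n) ℝ} {U : Matrix (Fin n) ι ℝ}
  {κ : Matrix (Fin n) (Fin n) ℝ}

/-- The determinant of the rescaled matrix tends to `det κ ≠ 0`. A null vector `x` of `K s` would
give a null vector of the rescaled matrix, so `U x = 0` and `x = W U x = 0`. -/
theorem eventually_isUnit_det (hWU : W * U = 1) (hκ : κ.det ≠ 0)
    (hK : ∀ q p : Fin n, (fun s => (Wᵀ * K s * W) q p - κ q p * s ^ ((p : ℕ) + q + 1))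
      =O[𝓝[>] (0 : ℝ)] (fun s => s ^ ((p : ℕ) + q + 2))) :
    ∀ᶠ s in 𝓝[>] (0 : ℝ), IsUnit (K s).det := by
  have h : Tendsto (fun s => (rescaled (K s) W s).det) (𝓝[>] (0 : ℝ)) (𝓝 κ.det) :=
    ((continuous_id.matrix_det).tendsto κ).comp (tendsto_rescaled hK)
  filter_upwards [h.eventually_ne hκ, self_mem_nhdsWithin] with s hdet hs
  have hs' : s ≠ 0 := (Set.mem_Ioi.1 hs).ne'
  rw [isUnit_iff_ne_zero]
  intro h0
  obtain ⟨x, hx, hKx⟩ := exists_mulVec_eq_zero_iff.2 h0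
  have hy := rescaled_mulVec (K := K s) hWU hs' x
  simp only [hKx, mulVec_zero, Pi.zero_apply, zero_div] at hy
  have hy0 := eq_zero_of_mulVec_eq_zero hdet (funext hy)
  have hUx : U *ᵥ x = 0 := by
    funext p
    have := congrFun hy0 p
    simpa [hs'] using this
  apply hx
  rw [← one_mulVec x, ← hWU, ← mulVec_mulVec, hUx, mulVec_zero]

/-- Residuals of graded size `s^{N+q+1}` become `O(s^N)` in the rescaled system, whose inverse stays
bounded. Undoing `y_p = s^p (U x)_p` costs `s^p`; `n ≤ N` makes `N - p` an honest difference. -/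
theorem isBigO_moment_sub (hWU : W * U = 1) (hκ : κ.det ≠ 0)
    (hK : ∀ q p : Fin n, (fun s => (Wᵀ * K s * W) q p - κ q p * s ^ ((p : ℕ) + q + 1))
      =O[𝓝[>] (0 : ℝ)] (fun s => s ^ ((p : ℕ) + q + 2)))
    {g v v' : ℝ → ι → ℝ} {N : ℕ} (hN : n ≤ N) (hv : ∀ᶠ s in 𝓝[>] (0 : ℝ), K s *ᵥ v s = g s)
    (hr : ∀ q : Fin n, (fun s => (Wᵀ *ᵥ (g s - K s *ᵥ v' s)) q)
      =O[𝓝[>] (0 : ℝ)] (fun s => s ^ (N + q + 1))) (p : Fin n) :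
    (fun s => (U *ᵥ (v s - v' s)) p) =O[𝓝[>] (0 : ℝ)] (fun s => s ^ (N - p)) := by
  have ht := tendsto_rescaled hK
  have hd : Tendsto (fun s => (rescaled (K s) W s).det) (𝓝[>] (0 : ℝ)) (𝓝 κ.det) :=
    ((continuous_id.matrix_det).tendsto κ).comp ht
  have ha : Tendsto (fun s => (rescaled (K s) W s).adjugate) (𝓝[>] (0 : ℝ)) (𝓝 κ.adjugate) :=
    ((continuous_id.matrix_adjugate).tendsto κ).comp ht
  -- Cramer's formula: adjugate over determinant converges, hence is bounded.
  have hinv : ∀ p q, (fun s => (rescaled (K s) W s).det⁻¹ * (rescaled (K s) W s).adjugate p q)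
      =O[𝓝[>] (0 : ℝ)] (fun _ => (1 : ℝ)) := fun p q =>
    ((hd.inv₀ hκ).mul (tendsto_pi_nhds.1 (tendsto_pi_nhds.1 ha p) q)).isBigO_one ℝ
  have hQy : ∀ q, (fun s => (rescaled (K s) W s *ᵥ
      fun p => s ^ (p : ℕ) * (U *ᵥ (v s - v' s)) p) q) =O[𝓝[>] (0 : ℝ)] (fun s => s ^ N) := by
    intro q
    have h := (hr q).mul (isBigO_refl (fun s : ℝ => (s ^ ((q : ℕ) + 1))⁻¹) (𝓝[>] (0 : ℝ)))
    refine h.congr' ?_ ?_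
    · filter_upwards [self_mem_nhdsWithin, hv] with s hs hvs
      rw [rescaled_mulVec hWU (Set.mem_Ioi.1 hs).ne', mulVec_sub (K s), hvs, div_eq_mul_inv]
    · filter_upwards [self_mem_nhdsWithin] with s hs
      have hs' : s ≠ 0 := (Set.mem_Ioi.1 hs).ne'
      field_simp
      ring
  have hy : (fun s => s ^ (p : ℕ) * (U *ᵥ (v s - v' s)) p)
      =O[𝓝[>] (0 : ℝ)] (fun s => s ^ N) := by
    have h : (fun s => ∑ q, ((rescaled (K s) W s).det⁻¹ * (rescaled (K s) W s).adjugate p q) *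
        (rescaled (K s) W s *ᵥ fun p => s ^ (p : ℕ) * (U *ᵥ (v s - v' s)) p) q)
        =O[𝓝[>] (0 : ℝ)] (fun s => s ^ N) := by
      refine IsBigO.fun_sum fun q _ => ?_
      simpa using (hinv p q).mul (hQy q)
    refine h.congr' ?_ EventuallyEq.rfl
    filter_upwards [hd.eventually_ne hκ] with s hs
    set y : Fin n → ℝ := fun p => s ^ (p : ℕ) * (U *ᵥ (v s - v' s)) p
    have h1 : (rescaled (K s) W s).adjugate *ᵥ (rescaled (K s) W s *ᵥ y)
        = (rescaled (K s) W s).det • y := by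
      rw [mulVec_mulVec, adjugate_mul, smul_mulVec, one_mulVec]
    have h2 := congrFun h1 p
    simp only [mulVec, dotProduct, Pi.smul_apply, smul_eq_mul] at h2 ⊢
    simp only [mul_assoc, ← Finset.mul_sum, h2]
    rw [inv_mul_cancel_left₀ hs]
    rfl
  have h := hy.mul (isBigO_refl (fun s : ℝ => (s ^ (p : ℕ))⁻¹) (𝓝[>] (0 : ℝ)))
  refine h.congr' ?_ ?_
  · filter_upwards [self_mem_nhdsWithin] with s hs
    have hs' : s ≠ 0 := (Set.mem_Ioi.1 hs).ne'
    field_simp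
  · filter_upwards [self_mem_nhdsWithin] with s hs
    have hs' : s ≠ 0 := (Set.mem_Ioi.1 hs).ne'
    rw [pow_sub₀ s hs' (p.2.le.trans hN)]

end LinearSystem

end RBFHFD

/-! ### Reduction of the symmetric collocation system to a square system in `m + r` unknowns. -/

namespace RBFHFD

open Matrix

/-- A translation invariant kernel on the integer nodes (`f0`), with its first (`f1`) and its
negated second (`f2`) derivative. -/
structure Kernel where
  f0 : ℤ → ℝ
  f1 : ℤ → ℝ
  f2 : ℤ → ℝ
  f0_neg : ∀ d, f0 (-d) = f0 d
  f1_neg : ∀ d, f1 (-d) = -f1 d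
  f2_neg : ∀ d, f2 (-d) = f2 d

/-- The collocation entries of a kernel, for nodes with spacing `h`. -/
noncomputable def Kernel.entries (k : Kernel) (h : ℝ) : Entries where
  φ i j := k.f0 (i - j)
  φ₁ i j := k.f1 (i - j) / h
  φ₂ i j := -k.f1 (i - j) / h
  φ₁₂ i j := k.f2 (i - j) / h ^ 2

/-- The nodes `-m, …, m`. -/
noncomputable def valNodes (m : ℕ) : Finset ℤ := Finset.Icc (-(m : ℤ)) m

/-- The nodes `±1, …, ±r`. -/
noncomputable def derNodes (r : ℕ) : Finset ℤ := (valNodes r).erase 0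

/-- The positive node number `i + 1`. -/
def pos {m : ℕ} (i : Fin m) : ℤ := (i : ℤ) + 1

theorem sum_valNodes (m : ℕ) (F : ℤ → ℝ) :
    ∑ i ∈ valNodes m, F i = F 0 + ∑ i : Fin m, (F (-pos i) + F (pos i)) := by
  induction m with
  | zero => simp [valNodes]
  | succ m ih =>
    have h : valNodes (m + 1) = insert (-((m : ℤ) + 1)) (insert ((m : ℤ) + 1) (valNodes m)) := by
      ext x
      simp only [valNodes, Finset.mem_insert, Finset.mem_Icc]
      omega
    rw [h, Finset.sum_insert, Finset.sum_insert, ih, Fin.sum_univ_castSucc]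
    · simp only [pos, Fin.val_castSucc, Fin.val_last]
      ring
    · simp [valNodes]
    · simp only [valNodes, Finset.mem_insert, Finset.mem_Icc]
      omega

theorem sum_derNodes (r : ℕ) (F : ℤ → ℝ) :
    ∑ i ∈ derNodes r, F i = ∑ i : Fin r, (F (-pos i) + F (pos i)) := by
  have h := Finset.add_sum_erase (valNodes r) F (a := 0) (by simp [valNodes])
  rw [sum_valNodes] at h
  exact add_left_cancel h

/-- The matrix of the reduced system for the unknowns `h α_{-i}`, `β_{-k}`. -/
def collocation {R : Type*} [AddCommGroup R] (m r : ℕ) (f0 f1 f2 : ℤ → R) :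
    Matrix (Fin m ⊕ Fin r) (Fin m ⊕ Fin r) R
  | Sum.inl j, Sum.inl i => f0 (pos j - pos i) - f0 (pos j + pos i)
  | Sum.inl j, Sum.inr k => f1 (pos j - pos k) + f1 (pos j + pos k)
  | Sum.inr l, Sum.inl i => f1 (pos l + pos i) - f1 (pos l - pos i)
  | Sum.inr l, Sum.inr k => f2 (pos l - pos k) + f2 (pos l + pos k)

/-- The right hand side of the reduced system. -/
def collocationRhs {R : Type*} (m r : ℕ) (f1 f2 : ℤ → R) : Fin m ⊕ Fin r → R
  | Sum.inl j => f1 (pos j)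
  | Sum.inr l => f2 (pos l)

/-- The value at the node `k ≥ 1` of a function given on `1, …, m`, and zero elsewhere. -/
def extend {m : ℕ} (a : Fin m → ℝ) (k : ℕ) : ℝ :=
  if h : 1 ≤ k ∧ k ≤ m then a ⟨k - 1, by omega⟩ else 0

theorem extend_pos {m : ℕ} (a : Fin m → ℝ) (i : Fin m) : extend a (pos i).natAbs = a i := by
  have h : (pos i).natAbs = i + 1 := by simp only [pos]; omega
  simp [extend, h]

theorem extend_zero {m : ℕ} (a : Fin m → ℝ) : extend a 0 = 0 := by simp [extend]

theorem extend_of_lt {m : ℕ} (a : Fin m → ℝ) {k : ℕ} (hk : m < k) : extend a k = 0 := by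
  simp only [extend]; rw [dif_neg (by omega)]

/-- The centrally symmetric weights with `h α_{-i} = v_i`, `β_{-k} = v_k`. -/
noncomputable def centralWeights {m r : ℕ} (h : ℝ) (v : Fin m ⊕ Fin r → ℝ) : Weights where
  α i := -(Int.sign i : ℝ) * extend (fun i => v (Sum.inl i)) i.natAbs / h
  β k := extend (fun k => v (Sum.inr k)) k.natAbs
  γ := 0

section centralWeights

variable {m r : ℕ} (h : ℝ) (v : Fin m ⊕ Fin r → ℝ)

theorem sign_pos {m : ℕ} (i : Fin m) : Int.sign (pos i) = 1 :=
  Int.sign_eq_one_of_pos (by simp only [pos]; omega)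

theorem isCentral_centralWeights : IsCentral (centralWeights h v) := by
  refine ⟨fun i => ?_, ?_, fun k => ?_, rfl⟩
  · simp only [centralWeights, Int.sign_neg, Int.natAbs_neg, Int.cast_neg]; ring
  · simp [centralWeights]
  · simp [centralWeights]

theorem centralWeights_α_neg (i : Fin m) : (centralWeights h v).α (-pos i) = v (Sum.inl i) / h := by
  simp only [centralWeights, Int.sign_neg, Int.natAbs_neg, extend_pos, sign_pos]
  simp

theorem centralWeights_α_pos (i : Fin m) :
    (centralWeights h v).α (pos i) = -(v (Sum.inl i) / h) := by
  rw [← centralWeights_α_neg, ← (isCentral_centralWeights h v).1, neg_neg]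

theorem centralWeights_β_neg (k : Fin r) : (centralWeights h v).β (-pos k) = v (Sum.inr k) := by
  simp only [centralWeights, Int.natAbs_neg, extend_pos]

theorem centralWeights_β_pos (k : Fin r) : (centralWeights h v).β (pos k) = v (Sum.inr k) := by
  rw [← centralWeights_β_neg h v, (isCentral_centralWeights h v).2.2.1]

theorem centralWeights_supp_α {i : ℤ} (hi : i ∉ valNodes m) : (centralWeights h v).α i = 0 := by
  simp only [centralWeights]
  rw [extend_of_lt _ (by simp only [valNodes, Finset.mem_Icc] at hi; omega)]
  simp

theorem centralWeights_supp_β {k : ℤ} (hk : k ∉ derNodes r) : (centralWeights h v).β k = 0 := by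
  simp only [centralWeights]
  by_cases h0 : k = 0
  · simp [h0, extend_zero]
  · rw [extend_of_lt]
    simp only [derNodes, valNodes, Finset.mem_erase, Finset.mem_Icc] at hk; omega

theorem sum_centralWeights_α : ∑ i ∈ valNodes m, (centralWeights h v).α i = 0 := by
  rw [sum_valNodes, (isCentral_centralWeights h v).2.1]
  simp [centralWeights_α_neg, centralWeights_α_pos]

/-- The left hand side of the equation with centre `j` (values). -/
def valRow (E : Entries) (S M : Finset ℤ) (w : Weights) (j : ℤ) : ℝ :=
  ∑ i ∈ S, w.α i * E.φ i j + ∑ k ∈ M, w.β k * E.φ₁ k j + w.γ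

/-- The left hand side of the equation with centre `l` (derivatives). -/
def derRow (E : Entries) (S M : Finset ℤ) (w : Weights) (l : ℤ) : ℝ :=
  ∑ i ∈ S, w.α i * E.φ₂ i l + ∑ k ∈ M, w.β k * E.φ₁₂ k l

variable (K : Kernel)

/-- Under `x ↦ -x` the kernel is invariant and the central functional changes sign, so its value
rows are odd in the centre. The derivative rows are even for the same reason. -/
theorem valRow_central_neg (j : ℤ) :
    valRow (K.entries h) (valNodes m) (derNodes r) (centralWeights h v) (-j)
      = -valRow (K.entries h) (valNodes m) (derNodes r) (centralWeights h v) j := by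
  have e1 : ∀ a : ℤ, K.f0 (-a - j) = K.f0 (a + j) := fun a => by rw [← K.f0_neg]; ring_nf
  have e2 : ∀ a : ℤ, K.f0 (a - j) = K.f0 (-a + j) := fun a => by rw [← K.f0_neg]; ring_nf
  have e3 : ∀ a : ℤ, K.f1 (-a - j) = -K.f1 (a + j) := fun a => by rw [← K.f1_neg]; ring_nf
  have e4 : ∀ a : ℤ, K.f1 (a - j) = -K.f1 (-a + j) := fun a => by rw [← K.f1_neg]; ring_nf
  simp only [valRow, Kernel.entries, sum_valNodes, sum_derNodes, centralWeights_α_neg,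
    centralWeights_α_pos, centralWeights_β_neg, centralWeights_β_pos,
    (isCentral_centralWeights h v).2.1, (isCentral_centralWeights h v).2.2.2, sub_neg_eq_add,
    e1, e2 (pos _), e3, e4 (pos _), neg_add, add_zero, zero_mul, zero_add,
    ← Finset.sum_neg_distrib]
  congr 1 <;> exact Finset.sum_congr rfl fun i _ => by ring

theorem derRow_central_neg (l : ℤ) :
    derRow (K.entries h) (valNodes m) (derNodes r) (centralWeights h v) (-l)
      = derRow (K.entries h) (valNodes m) (derNodes r) (centralWeights h v) l := by
  have e1 : ∀ a : ℤ, K.f2 (-a - l) = K.f2 (a + l) := fun a => by rw [← K.f2_neg]; ring_nf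
  have e2 : ∀ a : ℤ, K.f2 (a - l) = K.f2 (-a + l) := fun a => by rw [← K.f2_neg]; ring_nf
  have e3 : ∀ a : ℤ, K.f1 (-a - l) = -K.f1 (a + l) := fun a => by rw [← K.f1_neg]; ring_nf
  have e4 : ∀ a : ℤ, K.f1 (a - l) = -K.f1 (-a + l) := fun a => by rw [← K.f1_neg]; ring_nf
  simp only [derRow, Kernel.entries, sum_valNodes, sum_derNodes, centralWeights_α_neg,
    centralWeights_α_pos, centralWeights_β_neg, centralWeights_β_pos,
    (isCentral_centralWeights h v).2.1, sub_neg_eq_add,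
    e1, e2 (pos _), e3, e4 (pos _), zero_mul, zero_add]
  congr 1 <;> exact Finset.sum_congr rfl fun i _ => by ring

theorem valRow_central (j : Fin m) :
    valRow (K.entries h) (valNodes m) (derNodes r) (centralWeights h v) (-pos j)
      = (collocation m r K.f0 K.f1 K.f2 *ᵥ v) (Sum.inl j) / h := by
  have e (a b : ℤ) : -a + b = b - a := by ring
  simp only [valRow, Kernel.entries, sum_valNodes, sum_derNodes, centralWeights_α_neg,
    centralWeights_α_pos, centralWeights_β_neg, centralWeights_β_pos,
    (isCentral_centralWeights h v).2.1, (isCentral_centralWeights h v).2.2.2, sub_neg_eq_add,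
    zero_mul, zero_add, add_zero, mulVec, dotProduct, Fintype.sum_sum_type, collocation, add_div,
    Finset.sum_div]
  congr 1 <;> refine Finset.sum_congr rfl fun i _ => ?_ <;>
    rw [e (pos i), add_comm (pos i) (pos j)] <;> ring

theorem derRow_central (l : Fin r) :
    derRow (K.entries h) (valNodes m) (derNodes r) (centralWeights h v) (-pos l)
      = (collocation m r K.f0 K.f1 K.f2 *ᵥ v) (Sum.inr l) / h ^ 2 := by
  have e (a b : ℤ) : -a + b = b - a := by ring
  simp only [derRow, Kernel.entries, sum_valNodes, sum_derNodes, centralWeights_α_neg,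
    centralWeights_α_pos, centralWeights_β_neg, centralWeights_β_pos,
    (isCentral_centralWeights h v).2.1, sub_neg_eq_add,
    zero_mul, zero_add, mulVec, dotProduct, Fintype.sum_sum_type, collocation, add_div,
    Finset.sum_div]
  congr 1 <;> refine Finset.sum_congr rfl fun i _ => ?_ <;>
    rw [e (pos i), add_comm (pos i) (pos l)] <;> ring

theorem eq_neg_pos {m : ℕ} {j : ℤ} (hj : j ∈ valNodes m) (hj0 : j < 0) :
    ∃ i : Fin m, j = -pos i := by
  simp only [valNodes, Finset.mem_Icc] at hj
  exact ⟨⟨(-j - 1).toNat, by omega⟩, by simp only [pos]; omega⟩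

theorem neg_pos_mem {m : ℕ} (i : Fin m) : -pos i ∈ valNodes m ∧ -pos i < 0 := by
  simp only [valNodes, Finset.mem_Icc, pos]; omega

theorem isReducedWeights_centralWeights_iff {h : ℝ} (hh : h ≠ 0) :
    IsReducedWeights (K.entries h) (valNodes m) (derNodes r) (centralWeights h v) ↔
      collocation m r K.f0 K.f1 K.f2 *ᵥ v = collocationRhs m r K.f1 K.f2 := by
  have hc := isCentral_centralWeights h v
  constructor
  · intro H
    funext i
    rcases i with j | l
    · have h1 := H.eq_val _ (neg_pos_mem j).1 (neg_pos_mem j).2.le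
      have h2 := valRow_central h v K j
      rw [valRow, h1, eq_div_iff hh] at h2
      rw [← h2]
      simp only [Kernel.entries, collocationRhs, zero_sub, neg_neg]
      field_simp
    · have h1 := H.eq_der (-pos l) (Finset.mem_erase.2 ⟨(neg_pos_mem l).2.ne, (neg_pos_mem l).1⟩)
        (neg_pos_mem l).2
      have h2 := derRow_central h v K l
      rw [derRow, h1, eq_div_iff (pow_ne_zero 2 hh)] at h2
      rw [← h2]
      simp only [Kernel.entries, collocationRhs, zero_sub, neg_neg]
      field_simp
  · intro H
    refine ⟨fun i => centralWeights_supp_α h v, fun k => centralWeights_supp_β h v,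
      fun i _ => hc.1 i, hc.2.2.1, fun j hj hj0 => ?_, fun l hl hl0 => ?_,
      sum_centralWeights_α h v⟩
    · change valRow _ _ _ _ _ = _
      rcases hj0.lt_or_eq with hj0 | rfl
      · obtain ⟨i, rfl⟩ := eq_neg_pos hj hj0
        rw [valRow_central, H]
        simp [Kernel.entries, collocationRhs]
      -- The equation at the centre `0` is automatic: both sides are odd functions of the centre.
      · have h0 := valRow_central_neg h v K 0
        have f1 := K.f1_neg 0
        rw [neg_zero] at h0 f1
        have h1 : valRow (K.entries h) (valNodes m) (derNodes r) (centralWeights h v) 0 = 0 := by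
          linarith
        have f1' : K.f1 0 = 0 := by linarith
        rw [h1]; simp [Kernel.entries, f1']
    · change derRow _ _ _ _ _ = _
      obtain ⟨i, rfl⟩ := eq_neg_pos (Finset.mem_of_mem_erase hl) hl0
      rw [derRow_central, H]
      simp [Kernel.entries, collocationRhs]

/-- The equations at positive centres are the reflections of those at negative centres, which the
reduced system contains. -/
theorem isWeights_of_mulVec_eq {h : ℝ} (hh : h ≠ 0)
    (hv : collocation m r K.f0 K.f1 K.f2 *ᵥ v = collocationRhs m r K.f1 K.f2) :
    IsWeights (K.entries h) (valNodes m) (derNodes r) (centralWeights h v) := by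
  have H := (isReducedWeights_centralWeights_iff v K hh).2 hv
  refine ⟨H.supp_α, H.supp_β, fun j hj => ?_, fun l hl => ?_, H.eq_const⟩
  · rcases le_or_gt j 0 with hj0 | hj0
    · exact H.eq_val j hj hj0
    · have h1 := H.eq_val (-j) (by simp only [valNodes, Finset.mem_Icc] at hj ⊢; omega) (by omega)
      have h2 := valRow_central_neg h v K j
      rw [valRow, h1, valRow] at h2
      rw [← neg_eq_iff_eq_neg.2 h2]
      simp only [Kernel.entries, zero_sub, neg_neg, K.f1_neg]
      ring
  · rcases lt_trichotomy l 0 with hl0 | hl0 | hl0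
    · exact H.eq_der l hl hl0
    · simp [derNodes, hl0] at hl
    · have h1 := H.eq_der (-l)
        (by simp only [derNodes, valNodes, Finset.mem_erase, Finset.mem_Icc] at hl ⊢; omega)
        (by omega)
      have h2 := derRow_central_neg h v K l
      rw [derRow, h1, derRow] at h2
      rw [← h2]
      simp only [Kernel.entries, zero_sub, neg_neg, K.f2_neg]

end centralWeights

/-- The only data not prescribed by the imposed symmetry are `α_0` and `γ`. The first vanishes by `∑
α_i = 0`, the second by the equation at the centre `0`. -/
theorem IsReducedWeights.exists_central {m r : ℕ} {K : Kernel} {h : ℝ} (hh : h ≠ 0) {w : Weights}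
    (H : IsReducedWeights (K.entries h) (valNodes m) (derNodes r) w) :
    ∃ v : Fin m ⊕ Fin r → ℝ, w = centralWeights h v := by
  have hα0 : w.α 0 = 0 := by
    have h0 := H.eq_const
    rw [sum_valNodes, Finset.sum_eq_zero, add_zero] at h0
    · exact h0
    · intro i _
      rw [H.odd_α _ (by simp only [pos]; omega)]; ring
  have hodd : ∀ i, w.α (-i) = -w.α i := fun i => by
    rcases eq_or_ne i 0 with rfl | hi
    · simp [hα0]
    · exact H.odd_α i hi
  have hf1 : K.f1 0 = 0 := by have := K.f1_neg 0; rw [neg_zero] at this; linarith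
  -- At the centre `0` the contributions of `i` and `-i` cancel, and so does the right hand side,
  -- which leaves `γ`.
  have hγ : w.γ = 0 := by
    have h0 := H.eq_val 0 (by simp [valNodes]) le_rfl
    rw [sum_valNodes, sum_derNodes] at h0
    simpa [Kernel.entries, hα0, hodd, H.even_β, K.f0_neg, K.f1_neg, hf1, neg_div] using h0
  let v : Fin m ⊕ Fin r → ℝ :=
    Sum.elim (fun i => h * w.α (-pos i)) (fun k => w.β (-pos k))
  have hα : ∀ i, i < 0 → w.α i = (centralWeights h v).α i := fun i hi => by
    by_cases him : i ∈ valNodes m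
    · obtain ⟨j, rfl⟩ := eq_neg_pos him hi
      rw [centralWeights_α_neg]
      simp [v, hh]
    · rw [H.supp_α i him, centralWeights_supp_α h v him]
  have hβ : ∀ k, k < 0 → w.β k = (centralWeights h v).β k := fun k hk => by
    by_cases hkm : k ∈ derNodes r
    · obtain ⟨j, rfl⟩ := eq_neg_pos (Finset.mem_of_mem_erase hkm) hk
      rw [centralWeights_β_neg]
      simp [v]
    · rw [H.supp_β k hkm, centralWeights_supp_β h v hkm]
  have hc := isCentral_centralWeights h v
  refine ⟨v, ?_⟩
  obtain ⟨α, β, γ⟩ := w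
  have e1 : α = (centralWeights h v).α := by
    funext i
    rcases lt_trichotomy i 0 with hi | rfl | hi
    · exact hα i hi
    · rw [hc.2.1]; exact hα0
    · have := hα (-i) (by omega)
      rw [hc.1, hodd] at this
      exact neg_injective this
  have e2 : β = (centralWeights h v).β := by
    funext i
    rcases lt_trichotomy i 0 with hi | rfl | hi
    · exact hβ i hi
    · have h0 : (0 : ℤ) ∉ derNodes r := by simp [derNodes]
      rw [centralWeights_supp_β h v h0]; exact H.supp_β 0 h0
    · have := hβ (-i) (by omega)
      rwa [hc.2.2.1, H.even_β] at this
  have e3 : γ = (centralWeights h v).γ := hγ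
  rw [e1, e2, e3]

/-- The solution of the reduced system of a kernel. -/
noncomputable def Kernel.solution (K : Kernel) (m r : ℕ) : Fin m ⊕ Fin r → ℝ :=
  (collocation m r K.f0 K.f1 K.f2)⁻¹ *ᵥ collocationRhs m r K.f1 K.f2

theorem isReducedWeights_iff {m r : ℕ} {K : Kernel} {h : ℝ} (hh : h ≠ 0)
    (hK : IsUnit (collocation m r K.f0 K.f1 K.f2).det) (w : Weights) :
    IsReducedWeights (K.entries h) (valNodes m) (derNodes r) w ↔
      w = centralWeights h (K.solution m r) := by
  rw [Kernel.solution]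
  constructor
  · intro H
    obtain ⟨v, rfl⟩ := H.exists_central hh
    rw [isReducedWeights_centralWeights_iff v K hh] at H
    rw [← H, mulVec_mulVec, nonsing_inv_mul _ hK, one_mulVec]
  · rintro rfl
    rw [isReducedWeights_centralWeights_iff _ K hh, mulVec_mulVec, mul_nonsing_inv _ hK,
      one_mulVec]

end RBFHFD

/-! ### Positive definiteness of the Gaussian for Hermite data and unique solvability. -/

namespace RBFHFD

open Matrix

/-- The Gaussian `exp (-s d²)` with its derivatives. -/
noncomputable def gaussianKernel (s : ℝ) : Kernel where
  f0 d := Real.exp (-(s * (d : ℝ) ^ 2))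
  f1 d := -2 * s * d * Real.exp (-(s * (d : ℝ) ^ 2))
  f2 d := (2 * s - 4 * s ^ 2 * (d : ℝ) ^ 2) * Real.exp (-(s * (d : ℝ) ^ 2))
  f0_neg d := by simp
  f1_neg d := by simp
  f2_neg d := by simp

theorem hasSum_exp_series (z : ℝ) :
    HasSum (fun N : ℕ => z ^ N / (N.factorial : ℝ)) (Real.exp z) := by
  rw [Real.exp_eq_exp_ℝ]
  exact NormedSpace.expSeries_div_hasSum_exp z

theorem hasSum_nat_mul_exp_series (z : ℝ) :
    HasSum (fun N : ℕ => N * (z ^ N / (N.factorial : ℝ))) (z * Real.exp z) := by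
  rw [← hasSum_nat_add_iff' 1]
  simp only [Finset.sum_range_one, Nat.cast_zero, zero_mul, sub_zero]
  refine ((hasSum_exp_series z).mul_left z).congr_fun ?_
  intro N
  rw [Nat.factorial_succ]
  push_cast
  field_simp
  ring

/-- The series `∑ c^N x^N y^N / N! = exp(cxy)` together with its derivatives in `x`, in `y` and in
both, combined with coefficients `a, b` and `a', b'`. At `N = 0` the factor `N` removes the term
with the truncated exponent `N - 1`. -/
theorem hasSum_moment_mul_moment (c x y a b a' b' : ℝ) :
    HasSum (fun N : ℕ => c ^ N / (N.factorial : ℝ) *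
      ((a * x ^ N + b * (N * x ^ (N - 1))) * (a' * y ^ N + b' * (N * y ^ (N - 1)))))
      ((a * a' + b * a' * (c * y) + a * b' * (c * x) + b * b' * (c + c * (c * x * y)))
        * Real.exp (c * x * y)) := by
  have h0 := hasSum_exp_series (c * x * y)
  have h1 : ∀ x y : ℝ, HasSum (fun N : ℕ => c ^ N / (N.factorial : ℝ) * (N * x ^ (N - 1) * y ^ N))
      (c * y * Real.exp (c * x * y)) := by
    intro x y
    rw [← hasSum_nat_add_iff' 1]
    simp only [Finset.sum_range_one, Nat.cast_zero, zero_mul, mul_zero, sub_zero]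
    refine ((hasSum_exp_series (c * x * y)).mul_left (c * y)).congr_fun ?_
    intro N
    rw [Nat.factorial_succ, Nat.add_sub_cancel]
    push_cast
    field_simp
    ring
  have h2 : HasSum (fun N : ℕ => c ^ N / (N.factorial : ℝ) *
      (N * x ^ (N - 1) * (N * y ^ (N - 1)))) ((c + c * (c * x * y)) * Real.exp (c * x * y)) := by
    rw [← hasSum_nat_add_iff' 1]
    simp only [Finset.sum_range_one, Nat.cast_zero, zero_mul, mul_zero, sub_zero]
    have h := ((hasSum_nat_mul_exp_series (c * x * y)).add h0).mul_left c
    have e : c * (c * x * y * Real.exp (c * x * y) + Real.exp (c * x * y))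
      = (c + c * (c * x * y)) * Real.exp (c * x * y) := by ring
    rw [e] at h
    refine h.congr_fun ?_
    intro N
    rw [Nat.factorial_succ, Nat.add_sub_cancel]
    push_cast
    field_simp
    ring
  have h := (((h0.mul_left (a * a')).add ((h1 x y).mul_left (b * a'))).add
    ((h1 y x).mul_left (a * b'))).add (h2.mul_left (b * b'))
  have e : a * a' * Real.exp (c * x * y) + b * a' * (c * y * Real.exp (c * x * y))
      + a * b' * (c * x * Real.exp (c * y * x))
      + b * b' * ((c + c * (c * x * y)) * Real.exp (c * x * y))
      = (a * a' + b * a' * (c * y) + a * b' * (c * x) + b * b' * (c + c * (c * x * y)))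
        * Real.exp (c * x * y) := by
    rw [show c * y * x = c * x * y by ring]
    ring
  rw [e] at h
  exact h.congr_fun fun N => by ring

theorem eval_of_sq_dvd {p : Polynomial ℝ} {x : ℝ}
    (h : (Polynomial.X - Polynomial.C x) ^ 2 ∣ p) :
    p.eval x = 0 ∧ p.derivative.eval x = 0 := by
  obtain ⟨q, rfl⟩ := h
  simp [Polynomial.derivative_mul, Polynomial.derivative_pow]

/-- Hermite interpolation: the functionals `δ_x`, `δ'_x` are independent on polynomials. -/
theorem eq_zero_of_moments (S : Finset ℝ) (a b : ℝ → ℝ)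
    (h : ∀ N : ℕ, ∑ x ∈ S, (a x * x ^ N + b x * (N * x ^ (N - 1))) = 0) :
    ∀ x ∈ S, a x = 0 ∧ b x = 0 := by
  have hp : ∀ p : Polynomial ℝ, ∑ x ∈ S, (a x * p.eval x + b x * p.derivative.eval x) = 0 := by
    intro p
    induction p using Polynomial.induction_on' with
    | add p q hp hq =>
      rw [← add_zero (0 : ℝ)]
      nth_rewrite 1 [← hp]
      rw [← hq, ← Finset.sum_add_distrib]
      refine Finset.sum_congr rfl fun x _ => ?_
      simp only [Polynomial.eval_add, Polynomial.derivative_add]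
      ring
    | monomial N c =>
      rw [← mul_zero c, ← h N, Finset.mul_sum]
      refine Finset.sum_congr rfl fun x _ => ?_
      simp only [Polynomial.eval_monomial, Polynomial.derivative_monomial]
      ring
  intro x hx
  -- `P` has double zeros at all other nodes, so testing on multiples of `P` isolates `x`. The
  -- multiple `(X - x) P` vanishes at `x` with derivative `P(x) ≠ 0` and yields `b x`; then `P`
  -- itself yields `a x`.
  let P : Polynomial ℝ := ∏ y ∈ S.erase x, (Polynomial.X - Polynomial.C y) ^ 2
  have hdvd : ∀ y ∈ S.erase x, (Polynomial.X - Polynomial.C y) ^ 2 ∣ P := fun y hy =>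
    Finset.dvd_prod_of_mem (fun y => (Polynomial.X - Polynomial.C y) ^ 2) hy
  have hPx : P.eval x ≠ 0 := by
    simp only [P, Polynomial.eval_prod, Polynomial.eval_pow, Polynomial.eval_sub,
      Polynomial.eval_X, Polynomial.eval_C]
    refine Finset.prod_ne_zero_iff.2 fun y hy => pow_ne_zero 2 (sub_ne_zero.2 ?_)
    exact (Finset.ne_of_mem_erase hy).symm
  have key : ∀ p : Polynomial ℝ, P ∣ p → a x * p.eval x + b x * p.derivative.eval x = 0 := by
    intro p hPp
    rw [← hp p, eq_comm]
    refine Finset.sum_eq_single_of_mem x hx fun y hy hyx => ?_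
    obtain ⟨h1, h2⟩ := eval_of_sq_dvd ((hdvd y (Finset.mem_erase.2 ⟨hyx, hy⟩)).trans hPp)
    rw [h1, h2]; ring
  have hb : b x = 0 := by
    have := key ((Polynomial.X - Polynomial.C x) * P) (dvd_mul_left _ _)
    simpa [Polynomial.derivative_mul, hPx] using this
  refine ⟨?_, hb⟩
  have := key P dvd_rfl
  simpa [hb, hPx] using this

/-- The quadratic form of the Gaussian on combinations of `δ_i`, `δ'_i` is definite. -/
theorem eq_zero_of_gaussian_form_eq_zero {s : ℝ} (hs : 0 < s) (S : Finset ℤ) (a b : ℤ → ℝ)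
    (h : ∑ j ∈ S, ∑ i ∈ S, (a i * a j * (gaussianKernel s).f0 (i - j)
      + b i * a j * (gaussianKernel s).f1 (i - j) - a i * b j * (gaussianKernel s).f1 (i - j)
      + b i * b j * (gaussianKernel s).f2 (i - j)) = 0) :
    ∀ i ∈ S, a i = 0 ∧ b i = 0 := by
  let e : ℤ → ℝ := fun i => Real.exp (-(s * (i : ℝ) ^ 2))
  -- Moving the factor `e^{-sx²}` into the functional `a δ_i + b δ'_i` gives these coefficients, by
  -- the product rule.
  let a' : ℤ → ℝ := fun i => e i * (a i - 2 * s * i * b i)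
  let b' : ℤ → ℝ := fun i => e i * b i
  have hterm : ∀ i j : ℤ, HasSum (fun N : ℕ => (2 * s) ^ N / (N.factorial : ℝ) *
      ((a' i * (i : ℝ) ^ N + b' i * (N * (i : ℝ) ^ (N - 1))) *
        (a' j * (j : ℝ) ^ N + b' j * (N * (j : ℝ) ^ (N - 1)))))
      (a i * a j * (gaussianKernel s).f0 (i - j)
      + b i * a j * (gaussianKernel s).f1 (i - j) - a i * b j * (gaussianKernel s).f1 (i - j)
      + b i * b j * (gaussianKernel s).f2 (i - j)) := by
    intro i j
    have hexp : Real.exp (-(s * ((i - j : ℤ) : ℝ) ^ 2)) = e i * e j * Real.exp (2 * s * i * j) := by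
      simp only [e, ← Real.exp_add]
      push_cast
      congr 1
      ring
    convert hasSum_moment_mul_moment (2 * s) i j (a' i) (b' i) (a' j) (b' j) using 1
    simp only [gaussianKernel, hexp, a', b']
    push_cast
    ring
  have hsum := hasSum_sum fun j (_ : j ∈ S) => hasSum_sum fun i (_ : i ∈ S) => hterm i j
  rw [h] at hsum
  have hsq : ∀ N : ℕ, ∑ j ∈ S, ∑ i ∈ S, (2 * s) ^ N / (N.factorial : ℝ) *
      ((a' i * (i : ℝ) ^ N + b' i * (N * (i : ℝ) ^ (N - 1))) *
        (a' j * (j : ℝ) ^ N + b' j * (N * (j : ℝ) ^ (N - 1))))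
      = (2 * s) ^ N / (N.factorial : ℝ) *
        (∑ i ∈ S, (a' i * (i : ℝ) ^ N + b' i * (N * (i : ℝ) ^ (N - 1)))) ^ 2 := by
    intro N
    rw [sq, Finset.sum_mul_sum, Finset.sum_comm, Finset.mul_sum]
    exact Finset.sum_congr rfl fun i _ => by rw [Finset.mul_sum]
  simp only [hsq] at hsum
  have hzero := (hasSum_zero_iff_of_nonneg fun N => by positivity).1 hsum
  -- The floor extends coefficients indexed by integers to functions on `ℝ` that agree with them at
  -- the nodes.
  have hmom : ∀ N : ℕ, ∑ x ∈ S.map ⟨fun i : ℤ => (i : ℝ), Int.cast_injective⟩,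
      (a' ⌊x⌋ * x ^ N + b' ⌊x⌋ * (N * x ^ (N - 1))) = 0 := by
    intro N
    have h0 := congrFun hzero N
    have hc : (2 * s) ^ N / (N.factorial : ℝ) ≠ 0 := by positivity
    simpa [hc] using h0
  have hab := eq_zero_of_moments _ (fun x => a' ⌊x⌋) (fun x => b' ⌊x⌋) hmom
  intro i hi
  have h1 := hab (i : ℝ) (Finset.mem_map_of_mem _ hi)
  simp only [Int.floor_intCast, a', b', mul_eq_zero, e, Real.exp_ne_zero, false_or] at h1
  refine ⟨?_, h1.2⟩
  simpa [h1.2] using h1.1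

/-- Energy argument: value rows are multiplied by `h² α_j`, derivative rows by `h² β_j`, and summed.
The total is the definite quadratic form plus a multiple of `γ ∑ α_j = 0`. -/
theorem gaussian_homogeneous {s h : ℝ} (hs : 0 < s) (hh : h ≠ 0) {S M : Finset ℤ} (hMS : M ⊆ S)
    {w : Weights} (hβ : ∀ k, k ∉ M → w.β k = 0)
    (hval : ∀ j ∈ S, valRow ((gaussianKernel s).entries h) S M w j = 0)
    (hder : ∀ l ∈ M, derRow ((gaussianKernel s).entries h) S M w l = 0)
    (hsum : ∑ i ∈ S, w.α i = 0) : ∀ i ∈ S, w.α i = 0 ∧ w.β i = 0 := by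
  have hβS : ∀ F : ℤ → ℝ, ∑ k ∈ M, w.β k * F k = ∑ k ∈ S, w.β k * F k := fun F =>
    Finset.sum_subset hMS fun k _ hk => by rw [hβ k hk, zero_mul]
  have hform : ∑ j ∈ S, (h * w.α j * (h * valRow ((gaussianKernel s).entries h) S M w j)
      + w.β j * (h ^ 2 * derRow ((gaussianKernel s).entries h) S M w j)) = 0 := by
    refine Finset.sum_eq_zero fun j hj => ?_
    rw [hval j hj]
    by_cases hjM : j ∈ M
    · rw [hder j hjM]; ring
    · rw [hβ j hjM]; ring
  have h0 := eq_zero_of_gaussian_form_eq_zero hs S (fun i => h * w.α i) w.β ?_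
  · intro i hi
    simpa [hh] using h0 i hi
  · have hγ : ∑ j ∈ S, h * w.α j * (h * w.γ) = 0 := by
      rw [← Finset.sum_mul, ← Finset.mul_sum, hsum]; ring
    have hj : ∀ j, ∑ i ∈ S, (h * w.α i * (h * w.α j) * (gaussianKernel s).f0 (i - j)
        + w.β i * (h * w.α j) * (gaussianKernel s).f1 (i - j)
        - h * w.α i * w.β j * (gaussianKernel s).f1 (i - j)
        + w.β i * w.β j * (gaussianKernel s).f2 (i - j))
        = (h * w.α j * (h * valRow ((gaussianKernel s).entries h) S M w j)
          + w.β j * (h ^ 2 * derRow ((gaussianKernel s).entries h) S M w j))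
          - h * w.α j * (h * w.γ) := by
      intro j
      have e : h * w.α j * (h * valRow ((gaussianKernel s).entries h) S M w j)
          - h * w.α j * (h * w.γ) = h * w.α j * (h * ∑ i ∈ S,
            (w.α i * (gaussianKernel s).f0 (i - j)
              + w.β i * ((gaussianKernel s).f1 (i - j) / h))) := by
        simp only [valRow, hβS, Kernel.entries, Finset.sum_add_distrib]
        ring
      rw [add_sub_right_comm, e]
      simp only [derRow, hβS, Kernel.entries, ← Finset.sum_add_distrib, Finset.mul_sum]
      refine Finset.sum_congr rfl fun i _ => ?_
      field_simp
      ring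
    simp only [hj, Finset.sum_sub_distrib, hform, hγ, sub_zero]

theorem derNodes_subset {m r : ℕ} (hrm : r ≤ m) : derNodes r ⊆ valNodes m := by
  intro k hk
  simp only [derNodes, valNodes, Finset.mem_erase, Finset.mem_Icc] at hk ⊢
  omega

/-- A null vector gives central weights whose rows vanish at the negative centres, hence by parity
at all centres. Definiteness then forces these weights to vanish. -/
theorem isUnit_det_gaussian {m r : ℕ} (hrm : r ≤ m) {s : ℝ} (hs : 0 < s) :
    IsUnit (collocation m r (gaussianKernel s).f0 (gaussianKernel s).f1
      (gaussianKernel s).f2).det := by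
  rw [isUnit_iff_ne_zero]
  intro h0
  obtain ⟨v, hv, hKv⟩ := exists_mulVec_eq_zero_iff.2 h0
  have hval : ∀ j ∈ valNodes m, valRow ((gaussianKernel s).entries 1) (valNodes m) (derNodes r)
      (centralWeights 1 v) j = 0 := by
    have hneg : ∀ j ∈ valNodes m, j < 0 → valRow ((gaussianKernel s).entries 1) (valNodes m)
        (derNodes r) (centralWeights 1 v) j = 0 := fun j hj hj0 => by
      obtain ⟨i, rfl⟩ := eq_neg_pos hj hj0
      rw [valRow_central, hKv]
      simp
    intro j hj
    have hsym := valRow_central_neg 1 v (gaussianKernel s) j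
    rcases lt_trichotomy j 0 with hj0 | rfl | hj0
    · exact hneg j hj hj0
    · rw [neg_zero] at hsym
      linarith
    · rw [hneg (-j) (by simp only [valNodes, Finset.mem_Icc] at hj ⊢; omega) (by omega)] at hsym
      linarith
  have hder : ∀ l ∈ derNodes r, derRow ((gaussianKernel s).entries 1) (valNodes m) (derNodes r)
      (centralWeights 1 v) l = 0 := by
    have hneg : ∀ l ∈ valNodes r, l < 0 → derRow ((gaussianKernel s).entries 1) (valNodes m)
        (derNodes r) (centralWeights 1 v) l = 0 := fun l hl hl0 => by
      obtain ⟨i, rfl⟩ := eq_neg_pos hl hl0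
      rw [derRow_central, hKv]
      simp
    intro l hl
    obtain ⟨hl0, hl⟩ := Finset.mem_erase.1 hl
    rcases hl0.lt_or_gt with hl0 | hl0
    · exact hneg l hl hl0
    · rw [← derRow_central_neg]
      exact hneg (-l) (by simp only [valNodes, Finset.mem_Icc] at hl ⊢; omega) (by omega)
  have H := gaussian_homogeneous hs one_ne_zero (derNodes_subset hrm)
    (fun k => centralWeights_supp_β 1 v) hval hder (sum_centralWeights_α 1 v)
  apply hv
  funext i
  rcases i with i | k
  · have := (H _ (neg_pos_mem i).1).1
    rw [centralWeights_α_neg] at this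
    simpa using this
  · have := (H _ (derNodes_subset hrm
      (Finset.mem_erase.2 ⟨(neg_pos_mem k).2.ne, (neg_pos_mem k).1⟩))).2
    rwa [centralWeights_β_neg] at this

theorem isWeights_gaussian_unique {m r : ℕ} (hrm : r ≤ m) {s h : ℝ} (hs : 0 < s) (hh : h ≠ 0)
    {w w' : Weights} (H : IsWeights ((gaussianKernel s).entries h) (valNodes m) (derNodes r) w)
    (H' : IsWeights ((gaussianKernel s).entries h) (valNodes m) (derNodes r) w') : w = w' := by
  let d : Weights := ⟨fun i => w.α i - w'.α i, fun k => w.β k - w'.β k, w.γ - w'.γ⟩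
  have hrow : ∀ j, valRow ((gaussianKernel s).entries h) (valNodes m) (derNodes r) d j
      = valRow ((gaussianKernel s).entries h) (valNodes m) (derNodes r) w j
        - valRow ((gaussianKernel s).entries h) (valNodes m) (derNodes r) w' j := fun j => by
    simp only [valRow, d, sub_mul, Finset.sum_sub_distrib]; ring
  have hrow' : ∀ j, derRow ((gaussianKernel s).entries h) (valNodes m) (derNodes r) d j
      = derRow ((gaussianKernel s).entries h) (valNodes m) (derNodes r) w j
        - derRow ((gaussianKernel s).entries h) (valNodes m) (derNodes r) w' j := fun j => by
    simp only [derRow, d, sub_mul, Finset.sum_sub_distrib]; ring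
  have hβ : ∀ k, k ∉ derNodes r → d.β k = 0 := fun k hk => by
    simp only [d, H.supp_β k hk, H'.supp_β k hk, sub_zero]
  have hval : ∀ j ∈ valNodes m,
      valRow ((gaussianKernel s).entries h) (valNodes m) (derNodes r) d j = 0 := fun j hj => by
    rw [hrow, sub_eq_zero]
    exact (H.eq_val j hj).trans (H'.eq_val j hj).symm
  have hD := gaussian_homogeneous hs hh (derNodes_subset hrm) hβ hval
    (fun l hl => by
      rw [hrow', sub_eq_zero]
      exact (H.eq_der l hl).trans (H'.eq_der l hl).symm)
    (by simp only [d, Finset.sum_sub_distrib, H.eq_const, H'.eq_const, sub_zero])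
  have hα : w.α = w'.α := by
    funext i
    by_cases hi : i ∈ valNodes m
    · exact sub_eq_zero.1 (hD i hi).1
    · rw [H.supp_α i hi, H'.supp_α i hi]
  have hβ' : w.β = w'.β := by
    funext i
    by_cases hi : i ∈ valNodes m
    · exact sub_eq_zero.1 (hD i hi).2
    · have hi' : i ∉ derNodes r := fun h' => hi (derNodes_subset hrm h')
      rw [H.supp_β i hi', H'.supp_β i hi']
  -- Definiteness says nothing about `γ`; a single value equation determines it once `α` and `β` are
  -- known.
  have hγ : w.γ = w'.γ := by
    have h1 := H.eq_val 0 (by simp [valNodes])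
    have h2 := H'.eq_val 0 (by simp [valNodes])
    rw [hα, hβ'] at h1
    linarith
  obtain ⟨α, β, γ⟩ := w
  obtain ⟨α', β', γ'⟩ := w'
  simp only at hα hβ' hγ
  rw [hα, hβ', hγ]

theorem isWeights_gaussian_iff {m r : ℕ} (hrm : r ≤ m) {s h : ℝ} (hs : 0 < s) (hh : h ≠ 0)
    (w : Weights) :
    IsWeights ((gaussianKernel s).entries h) (valNodes m) (derNodes r) w ↔
      w = centralWeights h ((gaussianKernel s).solution m r) := by
  have h0 : IsWeights ((gaussianKernel s).entries h) (valNodes m) (derNodes r)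
      (centralWeights h ((gaussianKernel s).solution m r)) := by
    apply isWeights_of_mulVec_eq _ _ hh
    rw [Kernel.solution, mulVec_mulVec, mul_nonsing_inv _ (isUnit_det_gaussian hrm hs), one_mulVec]
  refine ⟨fun H => isWeights_gaussian_unique hrm hs hh H h0, ?_⟩
  rintro rfl
  exact h0

end RBFHFD

/-! ### Power series of the Gaussian kernel and of its truncations. -/

namespace RBFHFD

open Asymptotics

section PowerSeries

variable {f : ℝ → ℝ} {c : ℕ → ℝ}

theorem hasFPowerSeriesAt_of_hasSum (hf : ∀ x, HasSum (fun k => c k * x ^ k) (f x)) :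
    HasFPowerSeriesAt f (FormalMultilinearSeries.ofScalars ℝ c) 0 := by
  rw [hasFPowerSeriesAt_iff]
  refine Eventually.of_forall fun z => ?_
  simpa [FormalMultilinearSeries.coeff_ofScalars, mul_comm] using hf z

/-- Uniqueness of power series coefficients; this makes `taylorPoly` a partial sum of the known
series. -/
theorem iteratedDeriv_div_factorial_of_hasSum (hf : ∀ x, HasSum (fun k => c k * x ^ k) (f x))
    (k : ℕ) : iteratedDeriv k f 0 / (k.factorial : ℝ) = c k := by
  have h1 := hasFPowerSeriesAt_of_hasSum hf
  have h2 := h1.analyticAt.hasFPowerSeriesAt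
  have h3 := congrArg (fun p => FormalMultilinearSeries.coeff p k)
    (h2.eq_formalMultilinearSeries h1)
  simpa [FormalMultilinearSeries.coeff_ofScalars] using h3

theorem hasExpansion_of_hasSum (hf : ∀ x, HasSum (fun k => c k * x ^ k) (f x)) (N : ℕ) :
    HasExpansion f c N := by
  have h := (hasFPowerSeriesAt_of_hasSum hf).isBigO_sub_partialSum_pow N
  refine ((h.mono nhdsWithin_le_nhds).congr_left fun s => ?_).trans ?_
  · simp [FormalMultilinearSeries.partialSum, mul_comm]
  · exact IsBigO.of_bound 1 (by simp)

theorem taylorPoly_even (hf : ∀ x, HasSum (fun k => c k * x ^ (2 * k)) (f x)) (n : ℕ) (h : ℝ) :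
    taylorPoly (2 * n) f h = ∑ k ∈ Finset.range (n + 1), c k * h ^ (2 * k) := by
  have hf' : ∀ x, HasSum (fun k => (if Even k then c (k / 2) else 0) * x ^ k) (f x) := by
    intro x
    have hinj : Function.Injective fun k : ℕ => 2 * k := fun a b h => by simpa using h
    refine (hinj.hasSum_iff fun k hk => ?_).1 ?_
    · rw [if_neg, zero_mul]
      rintro ⟨j, rfl⟩
      exact hk ⟨j, by simp only; ring⟩
    · simpa [Function.comp_def] using hf x
  simp only [taylorPoly, iteratedDeriv_div_factorial_of_hasSum hf']
  induction n with
  | zero => simp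
  | succ n ih =>
    rw [Finset.sum_range_succ _ (n + 1), ← ih, show 2 * (n + 1) + 1 = 2 * n + 1 + 1 + 1 by ring,
      Finset.sum_range_succ, Finset.sum_range_succ]
    have e1 : ¬ Even (2 * n + 1) := by simp
    have e2 : Even (2 * n + 1 + 1) := ⟨n + 1, by ring⟩
    rw [if_neg e1, if_pos e2, show (2 * n + 1 + 1) / 2 = n + 1 by omega]
    ring

theorem taylorPoly_odd (hf : ∀ x, HasSum (fun k => c k * x ^ (2 * k + 1)) (f x)) (n : ℕ) (h : ℝ) :
    taylorPoly (2 * n) f h = ∑ k ∈ Finset.range n, c k * h ^ (2 * k + 1) := by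
  have hf' : ∀ x, HasSum (fun k => (if Even k then 0 else c (k / 2)) * x ^ k) (f x) := by
    intro x
    have hinj : Function.Injective fun k : ℕ => 2 * k + 1 := fun a b h => by simpa using h
    refine (hinj.hasSum_iff fun k hk => ?_).1 ?_
    · rw [if_pos, zero_mul]
      by_contra hk'
      obtain ⟨j, rfl⟩ := Nat.not_even_iff_odd.1 hk'
      exact hk ⟨j, rfl⟩
    · have e (k : ℕ) : (2 * k + 1) / 2 = k := by omega
      simpa [Function.comp_def, e] using hf x
  simp only [taylorPoly, iteratedDeriv_div_factorial_of_hasSum hf']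
  induction n with
  | zero => simp
  | succ n ih =>
    rw [Finset.sum_range_succ _ n, ← ih, show 2 * (n + 1) + 1 = 2 * n + 1 + 1 + 1 by ring,
      Finset.sum_range_succ, Finset.sum_range_succ]
    have e1 : ¬ Even (2 * n + 1) := by simp
    have e2 : Even (2 * n + 1 + 1) := ⟨n + 1, by ring⟩
    rw [if_neg e1, if_pos e2, show (2 * n + 1) / 2 = n by omega]
    ring

end PowerSeries

/-- The coefficient of `s ^ k` in `exp (-s d²)`. -/
def coeff0 (k : ℕ) (d : ℤ) : ℚ := (-1) ^ k * (d : ℚ) ^ (2 * k) / (k.factorial : ℚ)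

/-- The coefficient of `s ^ k` in `-2 s d exp (-s d²)`. -/
def coeff1 : ℕ → ℤ → ℚ
  | 0, _ => 0
  | k + 1, d => -2 * d * coeff0 k d

/-- The coefficient of `s ^ k` in `(2 s - 4 s² d²) exp (-s d²)`. -/
def coeff2 : ℕ → ℤ → ℚ
  | 0, _ => 0
  | k + 1, d => (4 * k + 2) * coeff0 k d

theorem coeff0_mul_pow (k : ℕ) (d : ℤ) (s : ℝ) :
    (coeff0 k d : ℝ) * s ^ k = (-(s * (d : ℝ) ^ 2)) ^ k / (k.factorial : ℝ) := by
  simp only [coeff0]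
  push_cast
  rw [neg_pow (s * _), mul_pow s, ← pow_mul]
  ring

theorem hasSum_coeff0 (d : ℤ) (s : ℝ) :
    HasSum (fun k => (coeff0 k d : ℝ) * s ^ k) (Real.exp (-(s * (d : ℝ) ^ 2))) := by
  simpa only [coeff0_mul_pow] using hasSum_exp_series (-(s * (d : ℝ) ^ 2))

theorem hasSum_coeff2 (d : ℤ) (s : ℝ) :
    HasSum (fun k => (coeff2 (k + 1) d : ℝ) * s ^ k)
      ((2 - 4 * s * (d : ℝ) ^ 2) * Real.exp (-(s * (d : ℝ) ^ 2))) := by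
  have h := ((hasSum_nat_mul_exp_series (-(s * (d : ℝ) ^ 2))).mul_left 4).add
    ((hasSum_exp_series (-(s * (d : ℝ) ^ 2))).mul_left 2)
  have e : 4 * (-(s * (d : ℝ) ^ 2) * Real.exp (-(s * (d : ℝ) ^ 2)))
      + 2 * Real.exp (-(s * (d : ℝ) ^ 2))
      = (2 - 4 * s * (d : ℝ) ^ 2) * Real.exp (-(s * (d : ℝ) ^ 2)) := by ring
  rw [e] at h
  refine h.congr_fun fun k => ?_
  simp only [coeff2, ← coeff0_mul_pow]
  push_cast
  ring

theorem gaussianKernel_f0_hasExpansion (d : ℤ) (N : ℕ) :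
    HasExpansion (fun s => (gaussianKernel s).f0 d) (fun k => (coeff0 k d : ℝ)) N :=
  hasExpansion_of_hasSum (hasSum_coeff0 d) N

theorem gaussianKernel_f1_hasExpansion (d : ℤ) (N : ℕ) :
    HasExpansion (fun s => (gaussianKernel s).f1 d) (fun k => (coeff1 k d : ℝ)) N := by
  have h := ((gaussianKernel_f0_hasExpansion d N).const_mul (-2 * d)).id_mul.of_succ
  convert h using 2 with s k
  · simp only [gaussianKernel]; ring
  · cases k <;> simp [coeff1]

theorem gaussianKernel_f2_hasExpansion (d : ℤ) (N : ℕ) :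
    HasExpansion (fun s => (gaussianKernel s).f2 d) (fun k => (coeff2 k d : ℝ)) N := by
  have h := (hasExpansion_of_hasSum (hasSum_coeff2 d) N).id_mul.of_succ
  convert h using 2 with s k
  · simp only [gaussianKernel]; ring
  · cases k <;> simp [coeff2]

theorem hasDerivAt_gaussian (c x y : ℝ) :
    HasDerivAt (fun s => Real.exp (-(c * (s - y) ^ 2)))
      (-2 * c * (x - y) * Real.exp (-(c * (x - y) ^ 2))) x := by
  have h1 : HasDerivAt (fun s => -(c * (s - y) ^ 2)) (-2 * c * (x - y)) x := by
    refine (((((hasDerivAt_id x).sub_const y).pow 2).const_mul c).neg).congr_deriv ?_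
    simp
    ring
  exact h1.exp.congr_deriv (mul_comm _ _)

theorem gaussianD₁_eq (ε x y : ℝ) :
    gaussianD₁ ε x y = -2 * ε ^ 2 * (x - y) * Real.exp (-(ε ^ 2 * (x - y) ^ 2)) :=
  (hasDerivAt_gaussian (ε ^ 2) x y).deriv

theorem gaussianD₂_eq (ε x y : ℝ) :
    gaussianD₂ ε x y = 2 * ε ^ 2 * (x - y) * Real.exp (-(ε ^ 2 * (x - y) ^ 2)) := by
  have h : (fun s => gaussian ε x s) = fun s => Real.exp (-(ε ^ 2 * (s - x) ^ 2)) := by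
    funext s; rw [gaussian, sub_sq_comm]
  rw [gaussianD₂, h, (hasDerivAt_gaussian (ε ^ 2) y x).deriv, sub_sq_comm]
  ring

theorem gaussianD₁₂_eq (ε x y : ℝ) :
    gaussianD₁₂ ε x y = (2 * ε ^ 2 - 4 * ε ^ 4 * (x - y) ^ 2) *
      Real.exp (-(ε ^ 2 * (x - y) ^ 2)) := by
  have h : (fun s => gaussianD₂ ε s y)
      = fun s => 2 * ε ^ 2 * (s - y) * Real.exp (-(ε ^ 2 * (s - y) ^ 2)) :=
    funext fun s => gaussianD₂_eq ε s y
  have hd := ((((hasDerivAt_id x).sub_const y).const_mul (2 * ε ^ 2)).mul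
    (hasDerivAt_gaussian (ε ^ 2) x y)).deriv
  rw [gaussianD₁₂, h]
  refine hd.trans ?_
  simp only [id]
  ring

theorem node_sub_node (x₀ h : ℝ) (i j : ℤ) : node x₀ h i - node x₀ h j = (i - j : ℤ) * h := by
  simp only [node]; push_cast; ring

/-- Translation invariance and scaling: `x₀` disappears, and `ε`, `h` enter only through `(εh)²`,
apart from one factor `1/h` per derivative. -/
theorem gaussianEntries_eq (ε x₀ : ℝ) {h : ℝ} (hh : h ≠ 0) :
    gaussianEntries ε x₀ h = (gaussianKernel ((ε * h) ^ 2)).entries h := by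
  have e (d : ℤ) : ε ^ 2 * ((d : ℝ) * h) ^ 2 = (ε * h) ^ 2 * (d : ℝ) ^ 2 := by ring
  simp only [gaussianEntries, Kernel.entries, gaussianKernel, gaussian, gaussianD₁_eq,
    gaussianD₂_eq, gaussianD₁₂_eq, node_sub_node, e, Entries.mk.injEq]
  refine ⟨trivial, ?_, ?_, ?_⟩ <;> funext i j <;> field_simp

/-- The Taylor polynomials of the Gaussian `exp (-s d²)` and of its derivatives, for entries that
are truncated at `h ^ (2 n)`. -/
noncomputable def truncatedKernel (n : ℕ) (s : ℝ) : Kernel where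
  f0 d := ∑ k ∈ Finset.range (n + 1), (coeff0 k d : ℝ) * s ^ k
  f1 d := ∑ k ∈ Finset.range (n + 1), (coeff1 k d : ℝ) * s ^ k
  -- Since `s^k` carries `h^{2k}` and this entry is divided by `h²`, degree `2n` in `h` keeps `k ≤ n
  -- + 1`. For `f1`, divided by `h`, the condition `2k - 1 ≤ 2n` still gives `k ≤ n`.
  f2 d := ∑ k ∈ Finset.range (n + 2), (coeff2 k d : ℝ) * s ^ k
  f0_neg d := by simp [coeff0, pow_mul]
  f1_neg d := by
    rw [← Finset.sum_neg_distrib]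
    refine Finset.sum_congr rfl fun k _ => ?_
    cases k <;> simp [coeff1, coeff0, pow_mul]
  f2_neg d := by
    refine Finset.sum_congr rfl fun k _ => ?_
    cases k <;> simp [coeff2, coeff0, pow_mul]

theorem truncatedEntries_eq (n : ℕ) (ε x₀ : ℝ) {h : ℝ} (hh : h ≠ 0) :
    truncatedEntries (2 * n) ε x₀ h = (truncatedKernel n ((ε * h) ^ 2)).entries h := by
  have e (d : ℤ) (h : ℝ) : ε ^ 2 * ((d : ℝ) * h) ^ 2 = (ε * h) ^ 2 * (d : ℝ) ^ 2 := by ring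
  simp only [truncatedEntries, gaussianEntries, Kernel.entries, truncatedKernel, gaussian,
    gaussianD₁_eq, gaussianD₂_eq, gaussianD₁₂_eq, node_sub_node, e, Entries.mk.injEq]
  refine ⟨?_, ?_, ?_, ?_⟩ <;> funext i j
  · rw [taylorPoly_even (c := fun k => (coeff0 k (i - j) : ℝ) * ε ^ (2 * k))]
    · exact Finset.sum_congr rfl fun k _ => by ring
    · intro x
      exact (hasSum_coeff0 (i - j) ((ε * x) ^ 2)).congr_fun fun k => by ring
  · rw [taylorPoly_odd (c := fun k => (coeff1 (k + 1) (i - j) : ℝ) * ε ^ (2 * k + 2)),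
      Finset.sum_range_succ']
    · simp only [coeff1, Rat.cast_zero, zero_mul, add_zero, Finset.sum_div]
      refine Finset.sum_congr rfl fun k _ => ?_
      field_simp
      ring
    · intro x
      refine (((hasSum_coeff0 (i - j) ((ε * x) ^ 2)).mul_left
        (-2 * ε ^ 2 * ((i - j : ℤ) * x))).congr_fun fun k => ?_)
      simp only [coeff1]
      push_cast
      ring
  · rw [taylorPoly_odd (c := fun k => -(coeff1 (k + 1) (i - j) : ℝ) * ε ^ (2 * k + 2)),
      Finset.sum_range_succ']
    · simp only [coeff1, Rat.cast_zero, zero_mul, add_zero, Finset.sum_div,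
        ← Finset.sum_neg_distrib]
      refine Finset.sum_congr rfl fun k _ => ?_
      field_simp
      ring
    · intro x
      refine (((hasSum_coeff0 (i - j) ((ε * x) ^ 2)).mul_left
        (2 * ε ^ 2 * ((i - j : ℤ) * x))).congr_fun fun k => ?_)
      simp only [coeff1]
      push_cast
      ring
  · rw [taylorPoly_even (c := fun k => (coeff2 (k + 1) (i - j) : ℝ) * ε ^ (2 * k + 2)),
      Finset.sum_range_succ' _ (n + 1)]
    · simp only [coeff2, Rat.cast_zero, zero_mul, add_zero, Finset.sum_div]
      refine Finset.sum_congr rfl fun k _ => ?_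
      field_simp
      ring
    · intro x
      have h := (hasSum_coeff2 (i - j) ((ε * x) ^ 2)).mul_left (ε ^ 2)
      have e' : ε ^ 2 * ((2 - 4 * (ε * x) ^ 2 * ((i - j : ℤ) : ℝ) ^ 2) *
          Real.exp (-((ε * x) ^ 2 * ((i - j : ℤ) : ℝ) ^ 2)))
          = (2 * ε ^ 2 - 4 * ε ^ 4 * (((i - j : ℤ) : ℝ) * x) ^ 2) *
          Real.exp (-((ε * x) ^ 2 * ((i - j : ℤ) : ℝ) ^ 2)) := by ring
      rw [e'] at h
      exact h.congr_fun fun k => by ring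

end RBFHFD

/-! ### Local truncation error by Taylor expansion. -/

namespace RBFHFD

open Asymptotics

theorem exists_of_isBigO {f : ℝ → ℝ} {k : ℕ} (h : f =O[𝓝[>] (0 : ℝ)] (fun s => s ^ k)) :
    ∃ C : ℝ, 0 ≤ C ∧ ∀ᶠ s in 𝓝[>] (0 : ℝ), |f s| ≤ C * s ^ k := by
  obtain ⟨C, hC, hb⟩ := h.exists_nonneg
  refine ⟨C, hC, ?_⟩
  filter_upwards [hb.bound, self_mem_nhdsWithin] with s hs hs0
  rwa [Real.norm_eq_abs, norm_pow, Real.norm_of_nonneg (Set.mem_Ioi.1 hs0).le] at hs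

theorem exists_pos_of_eventually {P : ℝ → Prop} (h : ∀ᶠ s in 𝓝[>] (0 : ℝ), P s) :
    ∃ δ : ℝ, 0 < δ ∧ ∀ s, 0 < s → s < δ → P s := by
  obtain ⟨δ, hδ, hsub⟩ := mem_nhdsGT_iff_exists_Ioo_subset.1 h
  exact ⟨δ, hδ, fun s h0 h1 => hsub ⟨h0, h1⟩⟩

theorem exists_pos_of_eventually_sq {P : ℝ → Prop} (h : ∀ᶠ s in 𝓝[>] (0 : ℝ), P s) :
    ∃ δ : ℝ, 0 < δ ∧ ∀ ε h : ℝ, 0 < ε → 0 < h → ε * h < δ → P ((ε * h) ^ 2) := by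
  obtain ⟨δ, hδ, H⟩ := exists_pos_of_eventually h
  -- For `εh < 1` one has `(εh)² < εh`, so smallness of `εh` gives smallness of `s`.
  refine ⟨min 1 δ, lt_min one_pos hδ, fun ε h hε hh hlt => H _ (by positivity) ?_⟩
  have h0 : 0 < ε * h := by positivity
  have h1 := hlt.trans_le (min_le_left _ _)
  have h2 := hlt.trans_le (min_le_right _ _)
  nlinarith

theorem taylor_isBigO {u : ℝ → ℝ} {x₀ : ℝ} {N : ℕ} (hu : ContDiffAt ℝ N u x₀) :
    (fun y => u (x₀ + y) - ∑ k ∈ Finset.range N, iteratedDeriv k u x₀ / (k.factorial : ℝ) * y ^ k)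
      =O[𝓝 (0 : ℝ)] (fun y => y ^ N) := by
  obtain ⟨t, ht, hut⟩ := hu.contDiffOn le_rfl (by simp)
  obtain ⟨ρ, hρ, hball⟩ := Metric.mem_nhds_iff.1 ht
  have hx : x₀ ∈ Metric.ball x₀ ρ := Metric.mem_ball_self hρ
  have h := taylor_isLittleO (convex_ball x₀ ρ) hx (hut.mono hball)
  rw [Metric.isOpen_ball.nhdsWithin_eq hx] at h
  have hmap : Tendsto (fun y : ℝ => x₀ + y) (𝓝 0) (𝓝 x₀) := by
    have hc : Continuous fun y : ℝ => x₀ + y := by fun_prop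
    simpa using hc.tendsto 0
  have h1 := (h.comp_tendsto hmap).isBigO
  -- The Peano form has degree `N` and error `o(y^N)`; the term of degree `N` is moved into the
  -- remainder.
  have h2 : (fun y : ℝ => iteratedDeriv N u x₀ / (N.factorial : ℝ) * y ^ N) =O[𝓝 (0 : ℝ)]
      (fun y => y ^ N) := (isBigO_refl _ _).const_mul_left _
  have h1' : (fun y => u (x₀ + y) -
      ∑ k ∈ Finset.range (N + 1), iteratedDeriv k u x₀ / (k.factorial : ℝ) * y ^ k)
      =O[𝓝 (0 : ℝ)] (fun y => y ^ N) := by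
    refine h1.congr (fun y => ?_) (fun y => by simp)
    simp only [Function.comp_apply, taylor_within_apply, add_sub_cancel_left, smul_eq_mul]
    congr 1
    refine Finset.sum_congr rfl fun k _ => ?_
    rw [iteratedDerivWithin_of_isOpen Metric.isOpen_ball hx]
    ring
  refine (h1'.add h2).congr_left fun y => ?_
  rw [Finset.sum_range_succ]
  ring

theorem sum_range_odd (n : ℕ) (c : ℕ → ℝ) (y : ℝ) :
    ∑ k ∈ Finset.range (2 * n + 3), c k * (-y) ^ k - ∑ k ∈ Finset.range (2 * n + 3), c k * y ^ k
      = -2 * ∑ p ∈ Finset.range (n + 1), c (2 * p + 1) * y ^ (2 * p + 1) := by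
  induction n with
  | zero => simp [Finset.sum_range_succ]; ring
  | succ n ih =>
    rw [show 2 * (n + 1) + 3 = 2 * n + 3 + 1 + 1 by ring, Finset.sum_range_succ,
      Finset.sum_range_succ, Finset.sum_range_succ _ (2 * n + 3 + 1),
      Finset.sum_range_succ _ (2 * n + 3), Finset.sum_range_succ _ (n + 1), mul_add, ← ih,
      show 2 * n + 3 + 1 = 2 * (n + 2) by ring, show 2 * n + 3 = 2 * (n + 1) + 1 by ring,
      Even.neg_pow (even_two_mul (n + 2)), Odd.neg_pow (odd_two_mul_add_one (n + 1))]
    ring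

theorem sum_range_even (n : ℕ) (c : ℕ → ℝ) (y : ℝ) :
    ∑ k ∈ Finset.range (2 * n + 2), c k * (-y) ^ k + ∑ k ∈ Finset.range (2 * n + 2), c k * y ^ k
      = 2 * ∑ p ∈ Finset.range (n + 1), c (2 * p) * y ^ (2 * p) := by
  induction n with
  | zero => simp [Finset.sum_range_succ]; ring
  | succ n ih =>
    rw [show 2 * (n + 1) + 2 = 2 * n + 2 + 1 + 1 by ring, Finset.sum_range_succ,
      Finset.sum_range_succ, Finset.sum_range_succ _ (2 * n + 2 + 1),
      Finset.sum_range_succ _ (2 * n + 2), Finset.sum_range_succ _ (n + 1), mul_add, ← ih,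
      show 2 * n + 2 + 1 = 2 * (n + 1) + 1 by ring, show 2 * n + 2 = 2 * (n + 1) by ring,
      Even.neg_pow (even_two_mul (n + 1)), Odd.neg_pow (odd_two_mul_add_one (n + 1))]
    ring

theorem isBigO_odd_remainder {u : ℝ → ℝ} {x₀ : ℝ} {n : ℕ}
    (hu : ContDiffAt ℝ ((2 * n + 3 : ℕ) : WithTop ℕ∞) u x₀) :
    (fun y => u (x₀ - y) - u (x₀ + y) + 2 * ∑ p ∈ Finset.range (n + 1),
      iteratedDeriv (2 * p + 1) u x₀ / ((2 * p + 1).factorial : ℝ) * y ^ (2 * p + 1))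
      =O[𝓝[>] (0 : ℝ)] (fun y => y ^ (2 * n + 3)) := by
  have h1 := taylor_isBigO hu
  have hneg : Tendsto (fun y : ℝ => -y) (𝓝 0) (𝓝 0) := by
    simpa using (continuous_neg.tendsto (0 : ℝ))
  have h2 := (h1.comp_tendsto hneg).trans (g := fun y : ℝ => (-y) ^ (2 * n + 3))
    (k := fun y : ℝ => y ^ (2 * n + 3)) (IsBigO.of_bound 1 (by simp))
  refine ((h2.sub h1).mono nhdsWithin_le_nhds).congr_left fun y => ?_
  have := sum_range_odd n (fun k => iteratedDeriv k u x₀ / (k.factorial : ℝ)) y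
  simp only [Function.comp_apply, ← sub_eq_add_neg] at this ⊢
  linarith

theorem isBigO_even_remainder {u : ℝ → ℝ} {x₀ : ℝ} {n : ℕ}
    (hu : ContDiffAt ℝ ((2 * n + 3 : ℕ) : WithTop ℕ∞) u x₀) :
    (fun y => deriv u (x₀ - y) + deriv u (x₀ + y) - 2 * ∑ p ∈ Finset.range (n + 1),
      iteratedDeriv (2 * p + 1) u x₀ / ((2 * p).factorial : ℝ) * y ^ (2 * p))
      =O[𝓝[>] (0 : ℝ)] (fun y => y ^ (2 * n + 2)) := by
  have hu' : ContDiffAt ℝ ((2 * n + 2 : ℕ) : WithTop ℕ∞) (deriv u) x₀ :=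
    ContDiffAt.derivWithin hu (by norm_cast)
  have h1 := taylor_isBigO hu'
  have hneg : Tendsto (fun y : ℝ => -y) (𝓝 0) (𝓝 0) := by
    simpa using (continuous_neg.tendsto (0 : ℝ))
  have h2 := (h1.comp_tendsto hneg).trans (g := fun y : ℝ => (-y) ^ (2 * n + 2))
    (k := fun y : ℝ => y ^ (2 * n + 2)) (IsBigO.of_bound 1 (by simp))
  refine ((h2.add h1).mono nhdsWithin_le_nhds).congr_left fun y => ?_
  have := sum_range_even n (fun k => iteratedDeriv k (deriv u) x₀ / (k.factorial : ℝ)) y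
  simp only [Function.comp_apply, ← sub_eq_add_neg, iteratedDeriv_succ'] at this ⊢
  linarith

/-- The functional `f ↦ ∑ v_i (f (-i) - f i) + ∑ v_k (f' (-k) + f' k)` on `x ^ (2 p + 1)`, as a row
of coefficients. -/
def momentRow {m r : ℕ} {R : Type*} [Ring R] (p : ℕ) : Fin m ⊕ Fin r → R
  | Sum.inl i => -2 * (pos i : R) ^ (2 * p + 1)
  | Sum.inr k => 2 * (2 * p + 1) * (pos k : R) ^ (2 * p)

/-- The error of the scaled formula with weights `v` on `x ^ (2 p + 1)`. -/
noncomputable def moment {m r : ℕ} (v : Fin m ⊕ Fin r → ℝ) (p : ℕ) : ℝ :=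
  ∑ i, momentRow p i * v i - if p = 0 then 1 else 0

/-- Adding and subtracting Taylor polynomials. Only odd monomials survive, because the central
formula annihilates even ones; in the remainder the sums are differences of `u` and sums of `u'` at
reflected points. -/
theorem lte_centralWeights {m r n : ℕ} (v : Fin m ⊕ Fin r → ℝ) (u : ℝ → ℝ) (x₀ : ℝ) {h : ℝ}
    (hh : h ≠ 0) (d : ℕ → ℝ) (hd : d 1 = deriv u x₀) :
    lte (valNodes m) (derNodes r) (centralWeights h v) u x₀ h
      = ∑ p ∈ Finset.range (n + 1),
          d (2 * p + 1) / ((2 * p + 1).factorial : ℝ) * h ^ (2 * p) * moment v p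
        + (∑ i : Fin m, v (Sum.inl i) / h * (u (x₀ - pos i * h) - u (x₀ + pos i * h)
            + 2 * ∑ p ∈ Finset.range (n + 1),
              d (2 * p + 1) / ((2 * p + 1).factorial : ℝ) * (pos i * h) ^ (2 * p + 1))
          + ∑ k : Fin r, v (Sum.inr k) * (deriv u (x₀ - pos k * h) + deriv u (x₀ + pos k * h)
            - 2 * ∑ p ∈ Finset.range (n + 1),
              d (2 * p + 1) / ((2 * p).factorial : ℝ) * (pos k * h) ^ (2 * p))) := by
  have e1 : ∑ p ∈ Finset.range (n + 1),
      d (2 * p + 1) / ((2 * p + 1).factorial : ℝ) * h ^ (2 * p) * moment v p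
      = ∑ i : Fin m, v (Sum.inl i) / h * (-2 * ∑ p ∈ Finset.range (n + 1),
          d (2 * p + 1) / ((2 * p + 1).factorial : ℝ) * (pos i * h) ^ (2 * p + 1))
        + ∑ k : Fin r, v (Sum.inr k) * (2 * ∑ p ∈ Finset.range (n + 1),
          d (2 * p + 1) / ((2 * p).factorial : ℝ) * (pos k * h) ^ (2 * p)) - deriv u x₀ := by
    have e2 : ∑ p ∈ Finset.range (n + 1), d (2 * p + 1) / ((2 * p + 1).factorial : ℝ) *
        h ^ (2 * p) * (if p = 0 then (1 : ℝ) else 0) = deriv u x₀ := by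
      rw [Finset.sum_eq_single 0]
      · simp [hd]
      · intro p _ hp
        simp [hp]
      · simp
    simp only [moment, mul_sub, Finset.sum_sub_distrib, e2, Fintype.sum_sum_type, momentRow,
      mul_add, Finset.sum_add_distrib, Finset.mul_sum]
    congr 2
    · rw [Finset.sum_comm]
      refine Finset.sum_congr rfl fun i _ => Finset.sum_congr rfl fun p _ => ?_
      rw [mul_pow, pow_succ h]
      field_simp
    · rw [Finset.sum_comm]
      refine Finset.sum_congr rfl fun i _ => Finset.sum_congr rfl fun p _ => ?_
      rw [Nat.factorial_succ]
      push_cast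
      have : (2 * (p : ℝ) + 1) ≠ 0 := by positivity
      field_simp
      ring
  have hn (j : ℤ) : node x₀ h (-j) = x₀ - j * h := by simp only [node]; push_cast; ring
  have hA : ∑ i : Fin m, ((centralWeights h v).α (-pos i) * u (node x₀ h (-pos i))
      + (centralWeights h v).α (pos i) * u (node x₀ h (pos i)))
      = ∑ i : Fin m, v (Sum.inl i) / h * (-2 * ∑ p ∈ Finset.range (n + 1),
          d (2 * p + 1) / ((2 * p + 1).factorial : ℝ) * (pos i * h) ^ (2 * p + 1))
        + ∑ i : Fin m, v (Sum.inl i) / h * (u (x₀ - pos i * h) - u (x₀ + pos i * h)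
            + 2 * ∑ p ∈ Finset.range (n + 1),
              d (2 * p + 1) / ((2 * p + 1).factorial : ℝ) * (pos i * h) ^ (2 * p + 1)) := by
    rw [← Finset.sum_add_distrib]
    refine Finset.sum_congr rfl fun i _ => ?_
    rw [centralWeights_α_neg, centralWeights_α_pos, hn, node]
    ring
  have hB : ∑ k : Fin r, ((centralWeights h v).β (-pos k) * deriv u (node x₀ h (-pos k))
      + (centralWeights h v).β (pos k) * deriv u (node x₀ h (pos k)))
      = ∑ k : Fin r, v (Sum.inr k) * (2 * ∑ p ∈ Finset.range (n + 1),
          d (2 * p + 1) / ((2 * p).factorial : ℝ) * (pos k * h) ^ (2 * p))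
        + ∑ k : Fin r, v (Sum.inr k) * (deriv u (x₀ - pos k * h) + deriv u (x₀ + pos k * h)
            - 2 * ∑ p ∈ Finset.range (n + 1),
              d (2 * p + 1) / ((2 * p).factorial : ℝ) * (pos k * h) ^ (2 * p)) := by
    rw [← Finset.sum_add_distrib]
    refine Finset.sum_congr rfl fun i _ => ?_
    rw [centralWeights_β_neg, centralWeights_β_pos, hn, node]
    ring
  rw [e1, lte, sum_valNodes, sum_derNodes, (isCentral_centralWeights h v).2.1, hA, hB]
  ring

/-- The power balance is `h^{2p} s^{n-p} = h^{2n} ε^{2(n-p)}`: each moment error has exactly the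
order that compensates its power of `h`. One further factor `s` gives `h^{2n+2} ε^{2(n-p+1)}`, hence
degree at most `n + 1` in `ε²`. -/
theorem hasLTE_of_moments {m r n : ℕ} {v : ℝ → Fin m ⊕ Fin r → ℝ} {q : ℕ → ℝ}
    (hv : ∀ i, (fun s => v s i) =O[𝓝[>] (0 : ℝ)] (fun s => s ^ 0))
    (hM : ∀ p ∈ Finset.range (n + 1), (fun s => moment (v s) p - q p * s ^ (n - p))
      =O[𝓝[>] (0 : ℝ)] (fun s => s ^ (n - p + 1))) :
    HasLTE (valNodes m) (derNodes r) (fun ε h => centralWeights h (v ((ε * h) ^ 2))) n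
      (fun ε d => ∑ p ∈ Finset.range (n + 1),
        d (2 * p + 1) / ((2 * p + 1).factorial : ℝ) * q p * ε ^ (2 * (n - p))) := by
  choose Cv hCv0 hCv using fun i => exists_of_isBigO (hv i)
  choose! Cm hCm0 hCm using fun p hp => exists_of_isBigO (hM p hp)
  obtain ⟨δ, hδ, H⟩ := exists_pos_of_eventually_sq
    ((eventually_all.2 hCv).and ((Finset.eventually_all _).2 hCm))
  refine ⟨δ, hδ, fun u x₀ hu => ?_⟩
  obtain ⟨C₁, hC₁, hR₁⟩ := exists_of_isBigO (isBigO_odd_remainder hu)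
  obtain ⟨C₂, hC₂, hR₂⟩ := exists_of_isBigO (isBigO_even_remainder hu)
  obtain ⟨η, hη, hR⟩ := exists_pos_of_eventually (hR₁.and hR₂)
  let d : ℕ → ℝ := fun k => iteratedDeriv k u x₀
  let B : ℝ := ∑ i : Fin m, Cv (Sum.inl i) * (C₁ * (pos i : ℝ) ^ (2 * n + 3))
    + ∑ k : Fin r, Cv (Sum.inr k) * (C₂ * (pos k : ℝ) ^ (2 * n + 2))
  -- The constant `B` bounds the Taylor remainders, the other coefficients the moment errors. The
  -- bound on `h` places every node within distance `η` of `x₀`, since node indices are at most `m +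
  -- r`.
  refine ⟨Polynomial.C B + ∑ p ∈ Finset.range (n + 1),
    Polynomial.C (|d (2 * p + 1) / ((2 * p + 1).factorial : ℝ)| * Cm p)
      * Polynomial.X ^ (n - p + 1), ?_, η / (m + r + 1), by positivity, ?_⟩
  · refine Polynomial.natDegree_add_le_of_degree_le (by simp)
      (Polynomial.natDegree_sum_le_of_forall_le _ _ fun p _ => ?_)
    exact (Polynomial.natDegree_C_mul_X_pow_le _ _).trans (by omega)
  intro ε h hε hh hh₀ hεh
  obtain ⟨hv', hM'⟩ := H ε h hε hh hεh
  set s := (ε * h) ^ 2 with hs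
  rw [lt_div_iff₀ (by positivity)] at hh₀
  have hpos : ∀ {l : ℕ} (i : Fin l), l ≤ m + r → 0 < (pos i : ℝ) * h ∧ (pos i : ℝ) * h < η := by
    intro l i hl
    have h1 : (pos i : ℝ) ≤ m + r + 1 := by
      have : pos i ≤ (m + r + 1 : ℤ) := by simp only [pos]; omega
      exact_mod_cast this
    have h2 : (0 : ℝ) < pos i := by
      have : 0 < pos i := by simp only [pos]; omega
      exact_mod_cast this
    exact ⟨by positivity, lt_of_le_of_lt (by nlinarith) hh₀⟩
  rw [lte_centralWeights (n := n) _ u x₀ hh.ne' d (by simp [d, iteratedDeriv_one])]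
  have hmain : |∑ p ∈ Finset.range (n + 1),
      d (2 * p + 1) / ((2 * p + 1).factorial : ℝ) * h ^ (2 * p) * moment (v s) p
      - h ^ (2 * n) * ∑ p ∈ Finset.range (n + 1),
        d (2 * p + 1) / ((2 * p + 1).factorial : ℝ) * q p * ε ^ (2 * (n - p))|
      ≤ h ^ (2 * n + 2) * ∑ p ∈ Finset.range (n + 1),
        |d (2 * p + 1) / ((2 * p + 1).factorial : ℝ)| * Cm p * (ε ^ 2) ^ (n - p + 1) := by
    rw [Finset.mul_sum, Finset.mul_sum, ← Finset.sum_sub_distrib]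
    refine (Finset.abs_sum_le_sum_abs _ _).trans (Finset.sum_le_sum fun p hp => ?_)
    obtain ⟨j, rfl⟩ : ∃ j, n = p + j :=
      ⟨n - p, by have := Finset.mem_range.1 hp; omega⟩
    have hb := hM' p hp
    rw [Nat.add_sub_cancel_left] at hb ⊢
    have e : d (2 * p + 1) / ((2 * p + 1).factorial : ℝ) * h ^ (2 * p) * moment (v s) p
        - h ^ (2 * (p + j)) * (d (2 * p + 1) / ((2 * p + 1).factorial : ℝ) * q p * ε ^ (2 * j))
        = d (2 * p + 1) / ((2 * p + 1).factorial : ℝ) * h ^ (2 * p)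
          * (moment (v s) p - q p * s ^ j) := by
      rw [hs]; ring
    rw [e, abs_mul, abs_mul, abs_of_nonneg (by positivity : 0 ≤ h ^ (2 * p))]
    calc _ ≤ |d (2 * p + 1) / ((2 * p + 1).factorial : ℝ)| * h ^ (2 * p)
          * (Cm p * s ^ (j + 1)) := by gcongr
      _ = _ := by rw [hs]; ring
  have hrem : |∑ i : Fin m, v s (Sum.inl i) / h * (u (x₀ - pos i * h) - u (x₀ + pos i * h)
            + 2 * ∑ p ∈ Finset.range (n + 1),
              d (2 * p + 1) / ((2 * p + 1).factorial : ℝ) * (pos i * h) ^ (2 * p + 1))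
          + ∑ k : Fin r, v s (Sum.inr k) * (deriv u (x₀ - pos k * h) + deriv u (x₀ + pos k * h)
            - 2 * ∑ p ∈ Finset.range (n + 1),
              d (2 * p + 1) / ((2 * p).factorial : ℝ) * (pos k * h) ^ (2 * p))|
      ≤ h ^ (2 * n + 2) * B := by
    rw [show h ^ (2 * n + 2) * B
      = ∑ i : Fin m, h ^ (2 * n + 2) * (Cv (Sum.inl i) * (C₁ * (pos i : ℝ) ^ (2 * n + 3)))
        + ∑ k : Fin r, h ^ (2 * n + 2) * (Cv (Sum.inr k) * (C₂ * (pos k : ℝ) ^ (2 * n + 2))) by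
      simp only [B, mul_add, Finset.mul_sum]]
    refine (abs_add_le _ _).trans (add_le_add ?_ ?_) <;>
    refine (Finset.abs_sum_le_sum_abs _ _).trans (Finset.sum_le_sum fun i _ => ?_)
    · have hp := hpos i (by omega)
      have h1 := (hR _ hp.1 hp.2).1
      have h2 := hv' (Sum.inl i)
      rw [pow_zero, mul_one] at h2
      rw [abs_mul, abs_div, abs_of_pos hh]
      calc _ ≤ Cv (Sum.inl i) / h * (C₁ * (pos i * h) ^ (2 * n + 3)) := by
            gcongr
            exact div_nonneg (hCv0 _) hh.le
        _ = _ := by rw [mul_pow, pow_succ h (2 * n + 2)]; field_simp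
    · have hp := hpos i (by omega)
      have h1 := (hR _ hp.1 hp.2).2
      have h2 := hv' (Sum.inr i)
      rw [pow_zero, mul_one] at h2
      rw [abs_mul]
      calc _ ≤ Cv (Sum.inr i) * (C₂ * (pos i * h) ^ (2 * n + 2)) := by gcongr; exact hCv0 _
        _ = _ := by ring
  rw [add_sub_right_comm]
  refine (abs_add_le _ _).trans ((add_le_add hmain hrem).trans (le_of_eq ?_))
  simp only [Polynomial.eval_add, Polynomial.eval_C, Polynomial.eval_finsetSum,
    Polynomial.eval_mul, Polynomial.eval_pow, Polynomial.eval_X]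
  ring

end RBFHFD

/-! ### From a finite rational certificate to expansions of the weights. -/

namespace RBFHFD

open Matrix Asymptotics

/-- The moments of the basis functionals, for the first `n` odd monomials. -/
def momentMatrix (n m r : ℕ) : Matrix (Fin n) (Fin m ⊕ Fin r) ℚ := fun p => momentRow (p : ℕ)

/-- The leading coefficients of the collocation matrix in the basis dual to the moments. -/
def leadingMatrix (n : ℕ) : Matrix (Fin n) (Fin n) ℚ := fun q p =>
  -- The coefficient of `x^{2p+1} y^{2q+1}` in `(-1)^k (x-y)^{2k} / k!` for `k = p + q + 1`, halved:
  -- antisymmetrizing the kernel gives a factor `2`, while two moment rows carry `4`.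
  (-1) ^ (p.val + q.val) * ((2 * p.val + 2 * q.val + 2).factorial : ℚ) /
    (2 * (2 * p.val + 1).factorial * (2 * q.val + 1).factorial * (p.val + q.val + 1).factorial)

/-- The inverse of `leadingMatrix`. -/
def leadingMatrixInv (n : ℕ) : Matrix (Fin n) (Fin n) ℚ := fun q p =>
  -- Up to diagonal factors `leadingMatrix` is the Gram matrix of the odd monomials for the weight
  -- `e^{-x²}`, whose moments are proportional to `(2k)!/(4^k k!)`. Its inverse sums, over `j`,
  -- products of coefficients of the normalized Hermite polynomials `H_{2j+1}`.
  ∑ j : Fin n, if p ≤ j ∧ q ≤ j then ((2 * j.val + 1).factorial : ℚ) /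
    (4 ^ j.val * (j.val - p.val).factorial * (j.val - q.val).factorial) else 0

/-- The coefficients of the polynomials
`δ_{p,0} + s ^ (n - p) (c_{p,0} + c_{p,1} s + c_{p,2} s²)`. -/
def momentCoeff {n : ℕ} (c : Matrix (Fin n) (Fin 3) ℚ) (l : ℕ) (p : Fin n) : ℚ :=
  (if l = 0 ∧ p.val = 0 then 1 else 0) +
    -- Moment `p` will be known modulo `s^{n+3-p}`, so three coefficients starting at `s^{n-p}` are
    -- all that matter. For the worst moment `p = n - 1` this means precision `O(s⁴)`, the precision
    -- required of the weights.
    if h : n ≤ l + p.val ∧ l + p.val < n + 3 then c p ⟨l + p.val - n, by omega⟩ else 0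

/-- The coefficients of the weights with the moments `momentCoeff c`, where `W` is the inverse
of the moment matrix. -/
def weightCoeff {m r n : ℕ} (W : Matrix (Fin m ⊕ Fin r) (Fin n) ℚ) (c : Matrix (Fin n) (Fin 3) ℚ)
    (l : ℕ) (i : Fin m ⊕ Fin r) : ℚ :=
  ∑ p, W i p * momentCoeff c l p

/-- The coefficients of the polynomial weights `weightCoeff W c` solve the collocation system
whose kernel has the coefficients `c0`, `c1`, `c2`, up to the order at which they are determined. -/
structure IsFormalSolution {m r n : ℕ} (c0 c1 c2 : ℕ → ℤ → ℚ)
    (W : Matrix (Fin m ⊕ Fin r) (Fin n) ℚ) (c : Matrix (Fin n) (Fin 3) ℚ) : Prop where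
  n_pos : 0 < n
  W_mul : W * momentMatrix n m r = 1
  mul_W : momentMatrix n m r * W = 1
  leading_mul : leadingMatrix n * leadingMatrixInv n = 1
  -- At order `s^k` only monomials `x^{2p'+1} y^{2q'+1}` with `p' + q' + 1 = k` occur, and `W` is
  -- dual to the first `n` odd monomials. For `k ≤ p + q + 1` only `(p', q') = (p, q)` can survive.
  leading : ∀ q p : Fin n, ∀ k < p.val + q.val + 2,
    (Wᵀ * collocation m r (c0 k) (c1 k) (c2 k) * W) q p
      = if k = p.val + q.val + 1 then leadingMatrix n q p else 0
  -- Coefficients of the Cauchy product of matrix and candidate, up to the graded order `N + q + 1`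
  -- with `N = n + 3`. The largest order needed is `2n + 3`, at `q = n - 1`.
  residual : ∀ q : Fin n, ∀ k < n + 3 + q.val + 1,
    ∑ i, W i q * (collocationRhs m r (c1 k) (c2 k) i - ∑ j, ∑ l ∈ Finset.range (n + 3),
      (if l ≤ k then collocation m r (c0 (k - l)) (c1 (k - l)) (c2 (k - l)) i j else 0)
        * weightCoeff W c l j) = 0

/-- The kernels `K s` have the power series coefficients `c0`, `c1`, `c2` up to order `N`. -/
structure HasKernelExpansion (K : ℝ → Kernel) (c0 c1 c2 : ℕ → ℤ → ℚ) (N : ℕ) : Prop where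
  f0 : ∀ d, HasExpansion (fun s => (K s).f0 d) (fun k => (c0 k d : ℝ)) N
  f1 : ∀ d, HasExpansion (fun s => (K s).f1 d) (fun k => (c1 k d : ℝ)) N
  f2 : ∀ d, HasExpansion (fun s => (K s).f2 d) (fun k => (c2 k d : ℝ)) N

section

variable {m r n : ℕ} {K : ℝ → Kernel} {c0 c1 c2 : ℕ → ℤ → ℚ}
  {W : Matrix (Fin m ⊕ Fin r) (Fin n) ℚ} {c : Matrix (Fin n) (Fin 3) ℚ}

theorem HasKernelExpansion.collocation {N : ℕ} (hK : HasKernelExpansion K c0 c1 c2 N)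
    (i j : Fin m ⊕ Fin r) :
    HasExpansion (fun s => collocation m r (K s).f0 (K s).f1 (K s).f2 i j)
      (fun k => ((collocation m r (c0 k) (c1 k) (c2 k) i j : ℚ) : ℝ)) N := by
  rcases i with i | i <;> rcases j with j | j <;>
    simp only [RBFHFD.collocation, Rat.cast_sub, Rat.cast_add]
  · exact (hK.f0 _).sub (hK.f0 _)
  · exact (hK.f1 _).add (hK.f1 _)
  · exact (hK.f1 _).sub (hK.f1 _)
  · exact (hK.f2 _).add (hK.f2 _)

theorem HasKernelExpansion.collocationRhs {N : ℕ} (hK : HasKernelExpansion K c0 c1 c2 N)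
    (i : Fin m ⊕ Fin r) :
    HasExpansion (fun s => collocationRhs m r (K s).f1 (K s).f2 i)
      (fun k => ((collocationRhs m r (c1 k) (c2 k) i : ℚ) : ℝ)) N := by
  rcases i with i | i
  · exact hK.f1 _
  · exact hK.f2 _

/-- The entries of a rational matrix, as real numbers. -/
noncomputable abbrev toReal {ι ι' : Type*} (A : Matrix ι ι' ℚ) : Matrix ι ι' ℝ :=
  A.map (Rat.castHom ℝ)

theorem isBigO_collocation_sub (hK : HasKernelExpansion K c0 c1 c2 (2 * n + 3))
    (H : IsFormalSolution c0 c1 c2 W c) (q p : Fin n) :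
    (fun s => ((toReal W)ᵀ * collocation m r (K s).f0 (K s).f1 (K s).f2 * toReal W) q p
      - toReal (leadingMatrix n) q p * s ^ (p.val + q.val + 1))
      =O[𝓝[>] (0 : ℝ)] (fun s => s ^ (p.val + q.val + 2)) := by
  have h : HasExpansion
      (fun s => ((toReal W)ᵀ * collocation m r (K s).f0 (K s).f1 (K s).f2 * toReal W) q p)
      (fun k => (((Wᵀ * collocation m r (c0 k) (c1 k) (c2 k) * W) q p : ℚ) : ℝ)) (2 * n + 3) := by
    simp only [Matrix.mul_apply, Rat.cast_sum, Rat.cast_mul]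
    exact HasExpansion.sum fun j _ => (HasExpansion.sum fun i _ =>
      (hK.collocation i j).const_mul _).mul_const _
  have h1 := h.isBigO_sub (j := p.val + q.val + 1) (by omega) fun k hk => by
    rw [H.leading q p k (by omega), if_neg (by omega), Rat.cast_zero]
  rw [H.leading q p _ (by omega), if_pos rfl] at h1
  exact h1

/-- The polynomial weights with the coefficients `weightCoeff W c`. -/
noncomputable def polyWeights (W : Matrix (Fin m ⊕ Fin r) (Fin n) ℚ)
    (c : Matrix (Fin n) (Fin 3) ℚ) (s : ℝ) (i : Fin m ⊕ Fin r) : ℝ :=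
  ∑ l ∈ Finset.range (n + 3), (weightCoeff W c l i : ℝ) * s ^ l

theorem isBigO_residual (hK : HasKernelExpansion K c0 c1 c2 (2 * n + 3))
    (H : IsFormalSolution c0 c1 c2 W c) (q : Fin n) :
    (fun s => ((toReal W)ᵀ *ᵥ (collocationRhs m r (K s).f1 (K s).f2
      - collocation m r (K s).f0 (K s).f1 (K s).f2 *ᵥ polyWeights W c s)) q)
      =O[𝓝[>] (0 : ℝ)] (fun s => s ^ (n + 3 + q.val + 1)) := by
  have h : HasExpansion (fun s => ((toReal W)ᵀ *ᵥ (collocationRhs m r (K s).f1 (K s).f2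
      - collocation m r (K s).f0 (K s).f1 (K s).f2 *ᵥ polyWeights W c s)) q)
      (fun k => ((∑ i, W i q * (collocationRhs m r (c1 k) (c2 k) i -
        ∑ j, ∑ l ∈ Finset.range (n + 3),
        (if l ≤ k then collocation m r (c0 (k - l)) (c1 (k - l)) (c2 (k - l)) i j else 0)
          * weightCoeff W c l j) : ℚ) : ℝ)) (2 * n + 3) := by
    have e : ∀ s i j, collocation m r (K s).f0 (K s).f1 (K s).f2 i j * polyWeights W c s j
        = ∑ l ∈ Finset.range (n + 3), (s ^ l * collocation m r (K s).f0 (K s).f1 (K s).f2 i j)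
          * (weightCoeff W c l j : ℝ) := fun s i j => by
      rw [polyWeights, Finset.mul_sum]
      exact Finset.sum_congr rfl fun l _ => by ring
    simp only [Matrix.mulVec, dotProduct, Pi.sub_apply, e]
    refine (HasExpansion.sum fun i _ => ((hK.collocationRhs i).sub (HasExpansion.sum fun j _ =>
      HasExpansion.sum fun l _ => ((hK.collocation i j).pow_mul l).mul_const
        (weightCoeff W c l j : ℝ))).const_mul ((toReal W)ᵀ q i)).congr_coeff fun k _ => ?_
    simp only [Rat.cast_sum, Rat.cast_mul, Rat.cast_sub,
      apply_ite (Rat.cast : ℚ → ℝ), Rat.cast_zero]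
    rfl
  exact h.isBigO (by omega) fun k hk => by rw [H.residual q k hk, Rat.cast_zero]

theorem toReal_mul_eq_one {ι ι' : Type*} [Fintype ι'] [DecidableEq ι] {A : Matrix ι ι' ℚ}
    {B : Matrix ι' ι ℚ} (h : A * B = 1) : toReal A * toReal B = 1 := by
  rw [toReal, toReal, ← Matrix.map_mul, h, Matrix.map_one _ (map_zero _) (map_one _)]

theorem IsFormalSolution.det_ne_zero (H : IsFormalSolution c0 c1 c2 W c) :
    (toReal (leadingMatrix n)).det ≠ 0 :=
  Matrix.det_ne_zero_of_right_inverse (toReal_mul_eq_one H.leading_mul)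

theorem eventually_isUnit_det_collocation (hK : HasKernelExpansion K c0 c1 c2 (2 * n + 3))
    (H : IsFormalSolution c0 c1 c2 W c) :
    ∀ᶠ s in 𝓝[>] (0 : ℝ), IsUnit (collocation m r (K s).f0 (K s).f1 (K s).f2).det :=
  eventually_isUnit_det (toReal_mul_eq_one H.W_mul) H.det_ne_zero (isBigO_collocation_sub hK H)

theorem isBigO_solution_sub (hK : HasKernelExpansion K c0 c1 c2 (2 * n + 3))
    (H : IsFormalSolution c0 c1 c2 W c) (p : Fin n) :
    (fun s => (toReal (momentMatrix n m r) *ᵥ ((K s).solution m r - polyWeights W c s)) p)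
      =O[𝓝[>] (0 : ℝ)] (fun s => s ^ (n + 3 - p.val)) := by
  refine isBigO_moment_sub (toReal_mul_eq_one H.W_mul) H.det_ne_zero (isBigO_collocation_sub hK H)
    (g := fun s => collocationRhs m r (K s).f1 (K s).f2) (by omega) ?_ (isBigO_residual hK H) p
  filter_upwards [eventually_isUnit_det_collocation hK H] with s hs
  rw [Kernel.solution, mulVec_mulVec, mul_nonsing_inv _ hs, one_mulVec]

/-- Returning to the weights through `W` mixes all moments, so the least precise one, `p = n - 1`,
dictates the order `4`. Terms of `polyWeights` from `s⁴` on are discarded. -/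
theorem hasExpansion_solution (hK : HasKernelExpansion K c0 c1 c2 (2 * n + 3))
    (H : IsFormalSolution c0 c1 c2 W c) (i : Fin m ⊕ Fin r) :
    HasExpansion (fun s => (K s).solution m r i) (fun l => (weightCoeff W c l i : ℝ)) 4 := by
  have hn := H.n_pos
  have h1 : (fun s => (K s).solution m r i - polyWeights W c s i)
      =O[𝓝[>] (0 : ℝ)] (fun s => s ^ 4) := by
    have h : ∀ s, (K s).solution m r i - polyWeights W c s i = ∑ p, toReal W i p *
        (toReal (momentMatrix n m r) *ᵥ ((K s).solution m r - polyWeights W c s)) p := fun s => by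
      change _ = (toReal W *ᵥ (toReal (momentMatrix n m r) *ᵥ
        ((K s).solution m r - polyWeights W c s))) i
      rw [mulVec_mulVec, toReal_mul_eq_one H.W_mul, one_mulVec, Pi.sub_apply]
    simp only [h]
    exact IsBigO.fun_sum fun p _ => (((isBigO_solution_sub hK H p).trans
      (pow_isBigO_pow (by omega))).const_mul_left _)
  have h2 : (fun s : ℝ => ∑ l ∈ Finset.Ico 4 (n + 3), (weightCoeff W c l i : ℝ) * s ^ l)
      =O[𝓝[>] (0 : ℝ)] (fun s => s ^ 4) :=
    IsBigO.fun_sum fun l hl => (pow_isBigO_pow (Finset.mem_Ico.1 hl).1).const_mul_left _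
  refine (h1.add h2).congr_left fun s => ?_
  rw [polyWeights, ← Finset.sum_range_add_sum_Ico _ (by omega : 4 ≤ n + 3)]
  ring

theorem momentMatrix_mulVec_polyWeights (H : IsFormalSolution c0 c1 c2 W c) (s : ℝ) (p : Fin n) :
    (toReal (momentMatrix n m r) *ᵥ polyWeights W c s) p
      = ∑ l ∈ Finset.range (n + 3), (momentCoeff c l p : ℝ) * s ^ l := by
  have h : ∀ l, momentMatrix n m r *ᵥ weightCoeff W c l = momentCoeff c l := fun l => by
    change momentMatrix n m r *ᵥ (W *ᵥ momentCoeff c l) = _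
    rw [mulVec_mulVec, H.mul_W, one_mulVec]
  simp only [← h, mulVec, dotProduct, polyWeights, Finset.mul_sum, Rat.cast_sum, Rat.cast_mul,
    Finset.sum_mul]
  rw [Finset.sum_comm]
  refine Finset.sum_congr rfl fun l _ => Finset.sum_congr rfl fun i _ => ?_
  simp only [Matrix.map_apply, Rat.coe_castHom]
  ring

theorem momentRow_cast (p : ℕ) (i : Fin m ⊕ Fin r) :
    ((momentRow p i : ℚ) : ℝ) = momentRow p i := by
  rcases i with i | i <;> simp [momentRow]

theorem hasExpansion_moment (hK : HasKernelExpansion K c0 c1 c2 (2 * n + 3))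
    (H : IsFormalSolution c0 c1 c2 W c) (p : Fin n) :
    HasExpansion (fun s => moment ((K s).solution m r) p)
      (fun l => (momentCoeff c l p : ℝ) - if l = 0 ∧ p.val = 0 then 1 else 0) (n + 3 - p) := by
  have h1 : HasExpansion (fun s => (toReal (momentMatrix n m r) *ᵥ (K s).solution m r) p)
      (fun l => (momentCoeff c l p : ℝ)) (n + 3 - p) := by
    refine (isBigO_solution_sub hK H p).congr_left fun s => ?_
    rw [mulVec_sub, Pi.sub_apply, momentMatrix_mulVec_polyWeights H]
    congr 1
    symm
    refine Finset.sum_subset (Finset.range_mono (by omega)) fun l _ hl => ?_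
    have hl' : n + 3 - p.val ≤ l := by simpa using hl
    have hz : momentCoeff c l p = 0 := by
      rw [momentCoeff, if_neg (by omega), dif_neg (by omega), add_zero]
    change (momentCoeff c l p : ℝ) * s ^ l = 0
    rw [hz, Rat.cast_zero, zero_mul]
  have h2 : HasExpansion (fun _ : ℝ => if p.val = 0 then (1 : ℝ) else 0)
      (fun l => if l = 0 ∧ p.val = 0 then 1 else 0) (n + 3 - p) := by
    refine HasExpansion.of_poly (L := 1) (fun s _ => ?_) (by omega) fun k hk =>
      if_neg (by omega)
    simp
  convert h1.sub h2 using 2 with s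
  simp only [moment, mulVec, dotProduct, Matrix.map_apply, Rat.coe_castHom, momentMatrix,
    momentRow_cast]

/-- The leading coefficients of the moments of the solution. -/
def leadingMoment (W : Matrix (Fin m ⊕ Fin r) (Fin n) ℚ) (c : Matrix (Fin n) (Fin 3) ℚ) (p : ℕ) :
    ℚ :=
  if h : p < n then c ⟨p, h⟩ 0 else ∑ i, momentRow p i * weightCoeff W c 0 i

/-- For `p < n` the leading coefficient comes from the graded estimate, which is sharper than the
expansion of the weights. The moment `p = n` is not a coordinate; its value at `s = 0` is computed
from the flat weights. -/
theorem isBigO_moment_sub_leadingMoment (hK : HasKernelExpansion K c0 c1 c2 (2 * n + 3))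
    (H : IsFormalSolution c0 c1 c2 W c) :
    ∀ p ∈ Finset.range (n + 1),
      (fun s => moment ((K s).solution m r) p - (leadingMoment W c p : ℝ) * s ^ (n - p))
        =O[𝓝[>] (0 : ℝ)] (fun s => s ^ (n - p + 1)) := by
  intro p hp
  have hn := H.n_pos
  rw [Finset.mem_range] at hp
  by_cases hpn : p < n
  · have h := (hasExpansion_moment hK H ⟨p, hpn⟩).isBigO_sub (j := n - p)
      (by simp only; omega) fun l hl => by
        rw [momentCoeff, dif_neg (by simp only; omega)]
        split_ifs <;> simp
    have e : ((momentCoeff c (n - p) ⟨p, hpn⟩ : ℚ) : ℝ) -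
        (if n - p = 0 ∧ p = 0 then 1 else 0) = (leadingMoment W c p : ℝ) := by
      rw [momentCoeff, leadingMoment, dif_pos hpn, dif_pos (by simp only; omega),
        if_neg (by simp only; omega), if_neg (by omega)]
      simp [Nat.sub_add_cancel hpn.le]
    simp only [e] at h
    exact h
  · obtain rfl : p = n := by omega
    have h1 : HasExpansion (fun s => moment ((K s).solution m r) p)
        (fun l => ∑ i, momentRow p i * (weightCoeff W c l i : ℝ)) 4 := by
      have h := HasExpansion.sum fun i (_ : i ∈ Finset.univ) =>
        (hasExpansion_solution hK H i).const_mul (momentRow p i)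
      simpa [moment, hn.ne'] using h
    have h2 := h1.isBigO_sub (j := 0) (by omega) (by simp)
    have e : ((leadingMoment W c p : ℚ) : ℝ)
        = ∑ i, momentRow p i * (weightCoeff W c 0 i : ℝ) := by
      rw [leadingMoment, dif_neg hpn]
      push_cast
      simp only [momentRow_cast]
    rw [Nat.sub_self, e]
    exact h2

/-- The weights for the shape parameter `ε` and the spacing `h`. -/
noncomputable def schemeWeights (m r : ℕ) (K : ℝ → Kernel) (ε h : ℝ) : Weights :=
  centralWeights h ((K ((ε * h) ^ 2)).solution m r)

theorem hasLTE_schemeWeights (hK : HasKernelExpansion K c0 c1 c2 (2 * n + 3))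
    (H : IsFormalSolution c0 c1 c2 W c) {Q : ℝ → (ℕ → ℝ) → ℝ} (q : Fin (n + 1) → ℚ)
    (hq : ∀ p : Fin (n + 1), leadingMoment W c p = q p)
    (hQ : ∀ ε d, Q ε d = ∑ p : Fin (n + 1), d (2 * p.val + 1) /
      ((2 * p.val + 1).factorial : ℝ) * (q p : ℝ) * ε ^ (2 * (n - p.val))) :
    HasLTE (valNodes m) (derNodes r) (schemeWeights m r K) n Q := by
  have h := hasLTE_of_moments (m := m) (r := r) (n := n) (v := fun s => (K s).solution m r)
    (fun i => (hasExpansion_solution hK H i).isBigO (by omega) (by simp))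
    (isBigO_moment_sub_leadingMoment hK H)
  simp only [Finset.sum_range, hq, ← hQ] at h
  exact h

theorem alphaExpansion_schemeWeights (hK : HasKernelExpansion K c0 c1 c2 (2 * n + 3))
    (H : IsFormalSolution c0 c1 c2 W c) {j : ℤ} (i : Fin m) (hj : j = -pos i) {a : Fin 4 → ℚ}
    (ha : ∀ l : Fin 4, weightCoeff W c l (Sum.inl i) = a l) :
    AlphaExpansion (fun ε h => (schemeWeights m r K ε h).α j) (a 0) (a 1) (a 2) (a 3) := by
  obtain ⟨C, -, hC⟩ := exists_of_isBigO (hasExpansion_solution hK H (Sum.inl i))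
  obtain ⟨δ, hδ, hb⟩ := exists_pos_of_eventually_sq hC
  refine ⟨C, δ, hδ, fun ε h hε hh hεh => ?_⟩
  have h0 := hb ε h hε hh hεh
  have e : ∀ l : Fin 4, (weightCoeff W c l (Sum.inl i) : ℝ) = a l := fun l => by rw [ha l]
  have e0 := e 0
  have e1 := e 1
  have e2 := e 2
  have e3 := e 3
  simp only [Fin.val_zero, Fin.val_one, Fin.val_two, show ((3 : Fin 4) : ℕ) = 3 from rfl]
    at e0 e1 e2 e3
  simp only [Finset.sum_range_succ, Finset.sum_range_zero, e0, e1, e2, e3] at h0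
  simp only [hj, schemeWeights, centralWeights_α_neg]
  have e4 : (K ((ε * h) ^ 2)).solution m r (Sum.inl i) / h - ((a 0 : ℝ) / h + a 1 * ε ^ 2 * h
      + a 2 * ε ^ 4 * h ^ 3 + a 3 * ε ^ 6 * h ^ 5)
      = ((K ((ε * h) ^ 2)).solution m r (Sum.inl i) - (0 + (a 0 : ℝ) * ((ε * h) ^ 2) ^ 0
        + a 1 * ((ε * h) ^ 2) ^ 1 + a 2 * ((ε * h) ^ 2) ^ 2 + a 3 * ((ε * h) ^ 2) ^ 3)) / h := by
    field_simp
    ring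
  rw [e4, abs_div, abs_of_pos hh, div_le_iff₀ hh]
  exact h0.trans_eq (by ring)

theorem betaExpansion_schemeWeights (hK : HasKernelExpansion K c0 c1 c2 (2 * n + 3))
    (H : IsFormalSolution c0 c1 c2 W c) {j : ℤ} (k : Fin r) (hj : j = -pos k) {b : Fin 4 → ℚ}
    (hb : ∀ l : Fin 4, weightCoeff W c l (Sum.inr k) = b l) :
    BetaExpansion (fun ε h => (schemeWeights m r K ε h).β j) (b 0) (b 1) (b 2) (b 3) := by
  obtain ⟨C, -, hC⟩ := exists_of_isBigO (hasExpansion_solution hK H (Sum.inr k))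
  obtain ⟨δ, hδ, hC'⟩ := exists_pos_of_eventually_sq hC
  refine ⟨C, δ, hδ, fun ε h hε hh hεh => ?_⟩
  have h0 := hC' ε h hε hh hεh
  have e : ∀ l : Fin 4, (weightCoeff W c l (Sum.inr k) : ℝ) = b l := fun l => by rw [hb l]
  have e0 := e 0
  have e1 := e 1
  have e2 := e 2
  have e3 := e 3
  simp only [Fin.val_zero, Fin.val_one, Fin.val_two, show ((3 : Fin 4) : ℕ) = 3 from rfl]
    at e0 e1 e2 e3
  simp only [Finset.sum_range_succ, Finset.sum_range_zero, e0, e1, e2, e3] at h0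
  simp only [hj, schemeWeights, centralWeights_β_neg]
  convert h0 using 2
  · ring
  · ring

end

/-- With `h` fixed the constraint `εh < δ` holds for all small `ε`, and the error carries `ε⁸`. -/
theorem tendsto_flat {C δ : ℝ} (hδ : 0 < δ) {h : ℝ} (hh : 0 < h) {f : ℝ → ℝ} {p : ℝ → ℝ}
    (hp : Continuous p) {k : ℝ} (hf : ∀ ε, 0 < ε → ε * h < δ → |f ε - p ε| ≤ C * (ε ^ 8 * k)) :
    Tendsto f (𝓝[>] 0) (𝓝 (p 0)) := by
  have h1 : Tendsto (fun ε => f ε - p ε) (𝓝[>] 0) (𝓝 0) := by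
    have hc : Tendsto (fun ε : ℝ => C * (ε ^ 8 * k)) (𝓝[>] 0) (𝓝 0) := by
      have : Continuous fun ε : ℝ => C * (ε ^ 8 * k) := by fun_prop
      simpa using (this.tendsto 0).mono_left nhdsWithin_le_nhds
    refine squeeze_zero_norm' ?_ hc
    filter_upwards [Ioo_mem_nhdsGT (div_pos hδ hh)] with ε hε
    exact hf ε hε.1 ((lt_div_iff₀ hh).1 hε.2)
  simpa using h1.add ((hp.tendsto 0).mono_left nhdsWithin_le_nhds)

theorem AlphaExpansion.flatLimit {a : ℝ → ℝ → ℝ} {c₀ c₁ c₂ c₃ : ℝ}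
    (H : AlphaExpansion a c₀ c₁ c₂ c₃) {c : ℝ → ℝ} (hc : ∀ h, c h = c₀ / h) : FlatLimit a c := by
  obtain ⟨C, δ, hδ, hb⟩ := H
  intro h hh
  have := tendsto_flat hδ hh (f := fun ε => a ε h) (p := fun ε => c₀ / h + c₁ * ε ^ 2 * h
    + c₂ * ε ^ 4 * h ^ 3 + c₃ * ε ^ 6 * h ^ 5) (by fun_prop) fun ε hε hlt => hb ε h hε hh hlt
  simpa [hc] using this

theorem BetaExpansion.flatLimit {b : ℝ → ℝ → ℝ} {c₀ c₁ c₂ c₃ : ℝ}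
    (H : BetaExpansion b c₀ c₁ c₂ c₃) : FlatLimit b fun _ => c₀ := by
  obtain ⟨C, δ, hδ, hb⟩ := H
  intro h hh
  have := tendsto_flat hδ hh (f := fun ε => b ε h) (p := fun ε => c₀ + c₁ * ε ^ 2 * h ^ 2
    + c₂ * ε ^ 4 * h ^ 4 + c₃ * ε ^ 6 * h ^ 6) (by fun_prop) fun ε hε hlt => hb ε h hε hh hlt
  simpa using this

end RBFHFD

/-! ### Rational certificates for the three formulas and the truncated system. -/

namespace RBFHFD

open Matrix

theorem nodes5_eq : nodes5 = valNodes 2 := by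
  ext x; simp only [nodes5, valNodes, Finset.mem_insert, Finset.mem_singleton, Finset.mem_Icc]
  omega

theorem nodes7_eq : nodes7 = valNodes 3 := by
  ext x; simp only [nodes7, valNodes, Finset.mem_insert, Finset.mem_singleton, Finset.mem_Icc]
  omega

theorem derNodes2_eq : derNodes2 = derNodes 1 := by
  ext x
  simp only [derNodes2, derNodes, valNodes, Finset.mem_insert, Finset.mem_singleton,
    Finset.mem_erase, Finset.mem_Icc]
  omega

theorem derNodes4_eq : derNodes4 = derNodes 2 := by
  ext x
  simp only [derNodes4, derNodes, valNodes, Finset.mem_insert, Finset.mem_singleton,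
    Finset.mem_erase, Finset.mem_Icc]
  omega

theorem areGaussianWeights_schemeWeights {m r : ℕ} (hrm : r ≤ m) :
    AreGaussianWeights (valNodes m) (derNodes r) (schemeWeights m r gaussianKernel) := by
  intro ε h hε hh x₀ v
  have hs : 0 < (ε * h) ^ 2 := by positivity
  rw [gaussianEntries_eq ε x₀ hh.ne']
  exact ⟨isWeights_gaussian_iff hrm hs hh.ne' v,
    isReducedWeights_iff hh.ne' (isUnit_det_gaussian hrm hs) v⟩

theorem hasKernelExpansion_gaussianKernel (N : ℕ) :
    HasKernelExpansion gaussianKernel coeff0 coeff1 coeff2 N :=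
  ⟨fun d => gaussianKernel_f0_hasExpansion d N, fun d => gaussianKernel_f1_hasExpansion d N,
    fun d => gaussianKernel_f2_hasExpansion d N⟩

/-- The coefficients `a k` for `k < L`, and zero from `L` on. -/
def truncateCoeff (L : ℕ) (a : ℕ → ℤ → ℚ) (k : ℕ) (d : ℤ) : ℚ := if k < L then a k d else 0

theorem hasExpansion_truncateCoeff {L N : ℕ} (hLN : L ≤ N) (a : ℕ → ℤ → ℚ) (d : ℤ) :
    HasExpansion (fun s => ∑ k ∈ Finset.range L, (a k d : ℝ) * s ^ k)
      (fun k => (truncateCoeff L a k d : ℝ)) N := by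
  refine HasExpansion.of_poly (L := L) (fun s _ => Finset.sum_congr rfl fun k hk => ?_) hLN
    fun k hk => ?_
  · rw [truncateCoeff, if_pos (Finset.mem_range.1 hk)]
  · rw [truncateCoeff, if_neg (by omega), Rat.cast_zero]

theorem hasKernelExpansion_truncatedKernel {n N : ℕ} (hN : n + 2 ≤ N) :
    HasKernelExpansion (truncatedKernel n) (truncateCoeff (n + 1) coeff0)
      (truncateCoeff (n + 1) coeff1) (truncateCoeff (n + 2) coeff2) N :=
  ⟨hasExpansion_truncateCoeff (by omega) _, hasExpansion_truncateCoeff (by omega) _,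
    hasExpansion_truncateCoeff hN _⟩

theorem areTruncatedWeights_schemeWeights {m r n L : ℕ} {c0 c1 c2 : ℕ → ℤ → ℚ}
    {W : Matrix (Fin m ⊕ Fin r) (Fin n) ℚ} {c : Matrix (Fin n) (Fin 3) ℚ}
    (hK : HasKernelExpansion (truncatedKernel L) c0 c1 c2 (2 * n + 3))
    (H : IsFormalSolution c0 c1 c2 W c) :
    AreTruncatedWeights (2 * L) (valNodes m) (derNodes r)
      (schemeWeights m r (truncatedKernel L)) := by
  obtain ⟨δ, hδ, hdet⟩ := exists_pos_of_eventually_sq (eventually_isUnit_det_collocation hK H)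
  refine ⟨δ, hδ, fun ε h hε hh hεh x₀ v => ?_⟩
  rw [truncatedEntries_eq L ε x₀ hh.ne']
  exact isReducedWeights_iff hh.ne' (hdet ε h hε hh hεh) v

/-- Inverse moments for function values at `±1, ±2` and derivatives at `±1`. -/
def momentInv21 : Matrix (Fin 2 ⊕ Fin 1) (Fin 3) ℚ :=
  Sum.elim ![![-7 / 9, 11 / 36, -1 / 36], ![-1 / 36, 1 / 18, -1 / 36]]
    ![![-1 / 3, 5 / 12, -1 / 12]]

/-- Inverse moments for function values and derivatives at `±1, ±2`. -/
def momentInv22 : Matrix (Fin 2 ⊕ Fin 2) (Fin 4) ℚ :=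
  Sum.elim ![![-20 / 27, 2 / 9, 1 / 36, -1 / 108], ![-25 / 216, 73 / 288, -23 / 144, 19 / 864]]
    ![![-4 / 9, 2 / 3, -1 / 4, 1 / 36], ![-1 / 36, 1 / 16, -1 / 24, 1 / 144]]

/-- Inverse moments for function values at `±1, ±2, ±3` and derivatives at `±1, ±2`. -/
def momentInv32 : Matrix (Fin 3 ⊕ Fin 2) (Fin 5) ℚ :=
  Sum.elim ![![-17 / 24, 61 / 432, 109 / 1152, -17 / 576, 7 / 3456],
      ![-101 / 600, 1663 / 4320, -1931 / 7200, 79 / 1440, -71 / 21600],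
      ![-1 / 600, 1 / 240, -11 / 3200, 1 / 960, -1 / 9600]]
    ![![-1 / 2, 29 / 36, -35 / 96, 1 / 16, -1 / 288],
      ![-1 / 20, 17 / 144, -7 / 80, 1 / 48, -1 / 720]]

/-- Moments of the sixth order formula. -/
def moments6 : Matrix (Fin 3) (Fin 3) ℚ :=
  ![![2 / 3, -1 / 7, -7 / 10], ![2, 12 / 7, -117 / 70], ![4, 68 / 7, 30 / 7]]

/-- Moments of the eighth order formula. -/
def moments8 : Matrix (Fin 4) (Fin 3) ℚ :=
  ![![-2 / 3, 4 / 27, 773 / 945], ![-8 / 3, -20 / 9, 2918 / 945], ![-8, -160 / 9, -190 / 63],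
    ![-16, -640 / 9, -808 / 9]]

/-- Moments of the tenth order formula. -/
def moments10 : Matrix (Fin 5) (Fin 3) ℚ :=
  ![![6 / 5, -19 / 55, -822 / 275], ![6, 342 / 55, -146 / 11], ![24, 3534 / 55, 348 / 55],
    ![72, 19608 / 55, 28524 / 55], ![144, 69768 / 55, 210192 / 55]]

/-- Moments of the tenth order formula for entries truncated at `h ^ 20`. -/
def truncatedMoments10 : Matrix (Fin 5) (Fin 3) ℚ :=
  ![![6 / 5, -7643037753797 / 147456000, -101510132132243 / 276480000],
    ![6, -7642757587397 / 36864000, -272151439621567 / 147456000],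
    ![24, -7642197254597 / 12288000, -5423557839227 / 768000],
    ![72, -7640796422597 / 6144000, -141137814161021 / 7372800],
    ![144, -7635193094597 / 6144000, -768910791689 / 24000]]

/-- The tables only have to be verified: every condition is a finite set of identities between
rational numbers. -/
theorem isFormalSolution6 : IsFormalSolution coeff0 coeff1 coeff2 momentInv21 moments6 where
  n_pos := by decide
  W_mul := by decide +kernel
  mul_W := by decide +kernel
  leading_mul := by decide +kernel
  leading := by decide +kernel
  residual := by decide +kernel

theorem isFormalSolution8 : IsFormalSolution coeff0 coeff1 coeff2 momentInv22 moments8 where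
  n_pos := by decide
  W_mul := by decide +kernel
  mul_W := by decide +kernel
  leading_mul := by decide +kernel
  leading := by decide +kernel
  residual := by decide +kernel

theorem isFormalSolution10 : IsFormalSolution coeff0 coeff1 coeff2 momentInv32 moments10 where
  n_pos := by decide
  W_mul := by decide +kernel
  mul_W := by decide +kernel
  leading_mul := by decide +kernel
  leading := by decide +kernel
  residual := by decide +kernel

/-- The leading conditions involve only `s^k` with `k ≤ 9`, which the truncation retains, while the
residuals reach `k = 12`. The missing orders alter the second and third columns of the moments but
not the first, so the weights change from the `ε⁴` term on and the leading truncation error does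
not. -/
theorem isFormalSolution_truncated10 :
    IsFormalSolution (truncateCoeff 11 coeff0) (truncateCoeff 11 coeff1) (truncateCoeff 12 coeff2)
      momentInv32 truncatedMoments10 where
  n_pos := by decide
  W_mul := by decide +kernel
  mul_W := by decide +kernel
  leading_mul := by decide +kernel
  leading := by decide +kernel
  residual := by decide +kernel

end RBFHFD

theorem mainTheorem1 :
    -- order 6
    (∃ w : ℝ → ℝ → Weights,
      AreGaussianWeights nodes5 derNodes2 w ∧
      (∀ ε h : ℝ, 0 < ε → 0 < h → IsCentral (w ε h)) ∧
      AlphaExpansion (fun ε h => (w ε h).α (-2)) (-1 / 36) (-1 / 9) (-10 / 63) (-8 / 189) ∧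
      AlphaExpansion (fun ε h => (w ε h).α (-1)) (-7 / 9) (-1 / 9) (43 / 126) (-43 / 378) ∧
      BetaExpansion (fun ε h => (w ε h).β (-1)) (-1 / 3) (-1 / 3) (1 / 42) (17 / 126) ∧
      FlatLimit (fun ε h => (w ε h).α (-2)) (fun h => -1 / (36 * h)) ∧
      FlatLimit (fun ε h => (w ε h).α (-1)) (fun h => -7 / (9 * h)) ∧
      FlatLimit (fun ε h => (w ε h).β (-1)) (fun _ => -1 / 3) ∧
      HasLTE nodes5 derNodes2 w 3 (fun ε d =>
        1 / 1260 * (840 * ε ^ 6 * d 1 + 420 * ε ^ 4 * d 3 + 42 * ε ^ 2 * d 5 + d 7))) ∧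
    -- order 8
    (∃ w : ℝ → ℝ → Weights,
      AreGaussianWeights nodes5 derNodes4 w ∧
      (∀ ε h : ℝ, 0 < ε → 0 < h → IsCentral (w ε h)) ∧
      AlphaExpansion (fun ε h => (w ε h).α (-2)) (-25 / 216) (-19 / 54) (-139 / 486) (46 / 243) ∧
      AlphaExpansion (fun ε h => (w ε h).α (-1)) (-20 / 27) (4 / 27) (106 / 243) (-62 / 243) ∧
      BetaExpansion (fun ε h => (w ε h).β (-2)) (-1 / 36) (-1 / 9) (-13 / 81) (-4 / 81) ∧
      BetaExpansion (fun ε h => (w ε h).β (-1)) (-4 / 9) (-4 / 9) (2 / 81) (14 / 81) ∧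
      FlatLimit (fun ε h => (w ε h).α (-2)) (fun h => -25 / (216 * h)) ∧
      FlatLimit (fun ε h => (w ε h).α (-1)) (fun h => -20 / (27 * h)) ∧
      FlatLimit (fun ε h => (w ε h).β (-2)) (fun _ => -1 / 36) ∧
      FlatLimit (fun ε h => (w ε h).β (-1)) (fun _ => -4 / 9) ∧
      HasLTE nodes5 derNodes4 w 4 (fun ε d =>
        -(2 / 3) * ε ^ 8 * d 1 - 4 / 9 * ε ^ 6 * d 3 - 1 / 15 * ε ^ 4 * d 5
          - 1 / 315 * ε ^ 2 * d 7 - 1 / 22680 * d 9)) ∧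
    -- order 10, the Gaussian system itself
    (∃ w : ℝ → ℝ → Weights,
      AreGaussianWeights nodes7 derNodes4 w ∧
      (∀ ε h : ℝ, 0 < ε → 0 < h → IsCentral (w ε h)) ∧
      AlphaExpansion (fun ε h => (w ε h).α (-3)) (-1 / 600) (-3 / 200) (-1257 / 22000) (-2403 / 22000) ∧
      AlphaExpansion (fun ε h => (w ε h).α (-2)) (-101 / 600) (-71 / 150) (-302 / 1375) (6928 / 12375) ∧
      AlphaExpansion (fun ε h => (w ε h).α (-1)) (-17 / 24) (7 / 24) (391 / 880) (-4043 / 7920) ∧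
      BetaExpansion (fun ε h => (w ε h).β (-2)) (-1 / 20) (-1 / 5) (-72 / 275) (16 / 825) ∧
      BetaExpansion (fun ε h => (w ε h).β (-1)) (-1 / 2) (-1 / 2) (21 / 220) (173 / 660) ∧
      FlatLimit (fun ε h => (w ε h).α (-3)) (fun h => -1 / (600 * h)) ∧
      FlatLimit (fun ε h => (w ε h).α (-2)) (fun h => -101 / (600 * h)) ∧
      FlatLimit (fun ε h => (w ε h).α (-1)) (fun h => -17 / (24 * h)) ∧
      FlatLimit (fun ε h => (w ε h).β (-2)) (fun _ => -1 / 20) ∧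
      FlatLimit (fun ε h => (w ε h).β (-1)) (fun _ => -1 / 2) ∧
      HasLTE nodes7 derNodes4 w 5 (fun ε d =>
        6 / 5 * ε ^ 10 * d 1 + ε ^ 8 * d 3 + 55440 / 277200 * ε ^ 6 * d 5
          + 3960 / 277200 * ε ^ 4 * d 7 + 110 / 277200 * ε ^ 2 * d 9 + 1 / 277200 * d 11)) ∧
    -- order 10, entries replaced with their Taylor polynomials in h up to degree 20
    (∃ w : ℝ → ℝ → Weights,
      AreTruncatedWeights 20 nodes7 derNodes4 w ∧
      (∃ δ : ℝ, 0 < δ ∧ ∀ ε h : ℝ, 0 < ε → 0 < h → ε * h < δ → IsCentral (w ε h)) ∧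
      AlphaExpansion (fun ε h => (w ε h).α (-3)) (-1 / 600) (-3 / 200)
        (7639616774597 / 58982400000) (6690462911023 / 3276800000) ∧
      AlphaExpansion (fun ε h => (w ε h).α (-2)) (-101 / 600) (-71 / 150)
        (542622915796387 / 132710400000) (4920524576353819 / 132710400000) ∧
      AlphaExpansion (fun ε h => (w ε h).α (-1)) (-17 / 24) (7 / 24)
        (-53491473198179 / 21233664000) (-299239342744897 / 10616832000) ∧
      BetaExpansion (fun ε h => (w ε h).β (-2)) (-1 / 20) (-1 / 5)
        (7641828614597 / 4423680000) (82219926605429 / 4423680000) ∧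
      BetaExpansion (fun ε h => (w ε h).β (-1)) (-1 / 2) (-1 / 2)
        (7643155718597 / 1769472000) (29645672092819 / 884736000) ∧
      FlatLimit (fun ε h => (w ε h).α (-3)) (fun h => -1 / (600 * h)) ∧
      FlatLimit (fun ε h => (w ε h).α (-2)) (fun h => -101 / (600 * h)) ∧
      FlatLimit (fun ε h => (w ε h).α (-1)) (fun h => -17 / (24 * h)) ∧
      FlatLimit (fun ε h => (w ε h).β (-2)) (fun _ => -1 / 20) ∧
      FlatLimit (fun ε h => (w ε h).β (-1)) (fun _ => -1 / 2) ∧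
      HasLTE nodes7 derNodes4 w 5 (fun ε d =>
        6 / 5 * ε ^ 10 * d 1 + ε ^ 8 * d 3 + 55440 / 277200 * ε ^ 6 * d 5
          + 3960 / 277200 * ε ^ 4 * d 7 + 110 / 277200 * ε ^ 2 * d 9 + 1 / 277200 * d 11)) := by
  rw [nodes5_eq, nodes7_eq, derNodes2_eq, derNodes4_eq]
  refine ⟨?_, ?_, ?_, ?_⟩
  -- The expansion order is `2n + 3`, with `n = 3` here and `n = 4, 5` for the other formulas.
  · have hK := hasKernelExpansion_gaussianKernel 9
    have hα2 : AlphaExpansion (fun ε h => (schemeWeights 2 1 gaussianKernel ε h).α (-2))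
        (-1 / 36) (-1 / 9) (-10 / 63) (-8 / 189) := by
      simpa using alphaExpansion_schemeWeights hK isFormalSolution6 1 (by decide)
        (a := ![-1 / 36, -1 / 9, -10 / 63, -8 / 189]) (by decide +kernel)
    have hα1 : AlphaExpansion (fun ε h => (schemeWeights 2 1 gaussianKernel ε h).α (-1))
        (-7 / 9) (-1 / 9) (43 / 126) (-43 / 378) := by
      simpa using alphaExpansion_schemeWeights hK isFormalSolution6 0 (by decide)
        (a := ![-7 / 9, -1 / 9, 43 / 126, -43 / 378]) (by decide +kernel)
    have hβ1 : BetaExpansion (fun ε h => (schemeWeights 2 1 gaussianKernel ε h).β (-1))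
        (-1 / 3) (-1 / 3) (1 / 42) (17 / 126) := by
      simpa using betaExpansion_schemeWeights hK isFormalSolution6 0 (by decide)
        (b := ![-1 / 3, -1 / 3, 1 / 42, 17 / 126]) (by decide +kernel)
    refine ⟨schemeWeights 2 1 gaussianKernel, areGaussianWeights_schemeWeights (by omega),
      fun ε h _ _ => isCentral_centralWeights _ _,
      hα2, hα1, hβ1,
      hα2.flatLimit fun h => by ring,
      hα1.flatLimit fun h => by ring,
      hβ1.flatLimit,
      -- The leading moments: the first column of `moments6`, followed by the moment on `x⁷` of the
      -- flat limit weights.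
      hasLTE_schemeWeights hK isFormalSolution6 ![2 / 3, 2, 4, 4] (by decide +kernel)
        fun ε d => ?_⟩
    simp [Fin.sum_univ_succ, Nat.factorial]
    ring
  · have hK := hasKernelExpansion_gaussianKernel 11
    have hα2 : AlphaExpansion (fun ε h => (schemeWeights 2 2 gaussianKernel ε h).α (-2))
        (-25 / 216) (-19 / 54) (-139 / 486) (46 / 243) := by
      simpa using alphaExpansion_schemeWeights hK isFormalSolution8 1 (by decide)
        (a := ![-25 / 216, -19 / 54, -139 / 486, 46 / 243]) (by decide +kernel)
    have hα1 : AlphaExpansion (fun ε h => (schemeWeights 2 2 gaussianKernel ε h).α (-1))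
        (-20 / 27) (4 / 27) (106 / 243) (-62 / 243) := by
      simpa using alphaExpansion_schemeWeights hK isFormalSolution8 0 (by decide)
        (a := ![-20 / 27, 4 / 27, 106 / 243, -62 / 243]) (by decide +kernel)
    have hβ2 : BetaExpansion (fun ε h => (schemeWeights 2 2 gaussianKernel ε h).β (-2))
        (-1 / 36) (-1 / 9) (-13 / 81) (-4 / 81) := by
      simpa using betaExpansion_schemeWeights hK isFormalSolution8 1 (by decide)
        (b := ![-1 / 36, -1 / 9, -13 / 81, -4 / 81]) (by decide +kernel)
    have hβ1 : BetaExpansion (fun ε h => (schemeWeights 2 2 gaussianKernel ε h).β (-1))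
        (-4 / 9) (-4 / 9) (2 / 81) (14 / 81) := by
      simpa using betaExpansion_schemeWeights hK isFormalSolution8 0 (by decide)
        (b := ![-4 / 9, -4 / 9, 2 / 81, 14 / 81]) (by decide +kernel)
    refine ⟨schemeWeights 2 2 gaussianKernel, areGaussianWeights_schemeWeights (by omega),
      fun ε h _ _ => isCentral_centralWeights _ _,
      hα2, hα1, hβ2, hβ1,
      hα2.flatLimit fun h => by ring,
      hα1.flatLimit fun h => by ring,
      hβ2.flatLimit,
      hβ1.flatLimit,
      hasLTE_schemeWeights hK isFormalSolution8 ![-2 / 3, -8 / 3, -8, -16, -16] (by decide +kernel)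
        fun ε d => ?_⟩
    simp [Fin.sum_univ_succ, Nat.factorial]
    ring
  · have hK := hasKernelExpansion_gaussianKernel 13
    have hα3 : AlphaExpansion (fun ε h => (schemeWeights 3 2 gaussianKernel ε h).α (-3))
        (-1 / 600) (-3 / 200) (-1257 / 22000) (-2403 / 22000) := by
      simpa using alphaExpansion_schemeWeights hK isFormalSolution10 2 (by decide)
        (a := ![-1 / 600, -3 / 200, -1257 / 22000, -2403 / 22000]) (by decide +kernel)
    have hα2 : AlphaExpansion (fun ε h => (schemeWeights 3 2 gaussianKernel ε h).α (-2))
        (-101 / 600) (-71 / 150) (-302 / 1375) (6928 / 12375) := by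
      simpa using alphaExpansion_schemeWeights hK isFormalSolution10 1 (by decide)
        (a := ![-101 / 600, -71 / 150, -302 / 1375, 6928 / 12375]) (by decide +kernel)
    have hα1 : AlphaExpansion (fun ε h => (schemeWeights 3 2 gaussianKernel ε h).α (-1))
        (-17 / 24) (7 / 24) (391 / 880) (-4043 / 7920) := by
      simpa using alphaExpansion_schemeWeights hK isFormalSolution10 0 (by decide)
        (a := ![-17 / 24, 7 / 24, 391 / 880, -4043 / 7920]) (by decide +kernel)
    have hβ2 : BetaExpansion (fun ε h => (schemeWeights 3 2 gaussianKernel ε h).β (-2))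
        (-1 / 20) (-1 / 5) (-72 / 275) (16 / 825) := by
      simpa using betaExpansion_schemeWeights hK isFormalSolution10 1 (by decide)
        (b := ![-1 / 20, -1 / 5, -72 / 275, 16 / 825]) (by decide +kernel)
    have hβ1 : BetaExpansion (fun ε h => (schemeWeights 3 2 gaussianKernel ε h).β (-1))
        (-1 / 2) (-1 / 2) (21 / 220) (173 / 660) := by
      simpa using betaExpansion_schemeWeights hK isFormalSolution10 0 (by decide)
        (b := ![-1 / 2, -1 / 2, 21 / 220, 173 / 660]) (by decide +kernel)
    refine ⟨schemeWeights 3 2 gaussianKernel, areGaussianWeights_schemeWeights (by omega),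
      fun ε h _ _ => isCentral_centralWeights _ _,
      hα3, hα2, hα1, hβ2, hβ1,
      hα3.flatLimit fun h => by ring,
      hα2.flatLimit fun h => by ring,
      hα1.flatLimit fun h => by ring,
      hβ2.flatLimit,
      hβ1.flatLimit,
      hasLTE_schemeWeights hK isFormalSolution10 ![6 / 5, 6, 24, 72, 144, 144] (by decide +kernel)
        fun ε d => ?_⟩
    simp [Fin.sum_univ_succ, Nat.factorial]
    ring
  -- Here `n = 10` is half the truncation degree `20`, whereas `N = 13` is `2 · 5 + 3`.
  · have hK := hasKernelExpansion_truncatedKernel (n := 10) (N := 13) (by omega)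
    have hα3 : AlphaExpansion (fun ε h => (schemeWeights 3 2 (truncatedKernel 10) ε h).α (-3))
        (-1 / 600) (-3 / 200)
        (7639616774597 / 58982400000) (6690462911023 / 3276800000) := by
      simpa using alphaExpansion_schemeWeights hK isFormalSolution_truncated10 2 (by decide)
        (a := ![-1 / 600, -3 / 200,
          7639616774597 / 58982400000, 6690462911023 / 3276800000]) (by decide +kernel)
    have hα2 : AlphaExpansion (fun ε h => (schemeWeights 3 2 (truncatedKernel 10) ε h).α (-2))
        (-101 / 600) (-71 / 150)
        (542622915796387 / 132710400000) (4920524576353819 / 132710400000) := by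
      simpa using alphaExpansion_schemeWeights hK isFormalSolution_truncated10 1 (by decide)
        (a := ![-101 / 600, -71 / 150,
          542622915796387 / 132710400000, 4920524576353819 / 132710400000]) (by decide +kernel)
    have hα1 : AlphaExpansion (fun ε h => (schemeWeights 3 2 (truncatedKernel 10) ε h).α (-1))
        (-17 / 24) (7 / 24)
        (-53491473198179 / 21233664000) (-299239342744897 / 10616832000) := by
      simpa using alphaExpansion_schemeWeights hK isFormalSolution_truncated10 0 (by decide)
        (a := ![-17 / 24, 7 / 24,
          -53491473198179 / 21233664000, -299239342744897 / 10616832000]) (by decide +kernel)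
    have hβ2 : BetaExpansion (fun ε h => (schemeWeights 3 2 (truncatedKernel 10) ε h).β (-2))
        (-1 / 20) (-1 / 5)
        (7641828614597 / 4423680000) (82219926605429 / 4423680000) := by
      simpa using betaExpansion_schemeWeights hK isFormalSolution_truncated10 1 (by decide)
        (b := ![-1 / 20, -1 / 5,
          7641828614597 / 4423680000, 82219926605429 / 4423680000]) (by decide +kernel)
    have hβ1 : BetaExpansion (fun ε h => (schemeWeights 3 2 (truncatedKernel 10) ε h).β (-1))
        (-1 / 2) (-1 / 2)
        (7643155718597 / 1769472000) (29645672092819 / 884736000) := by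
      simpa using betaExpansion_schemeWeights hK isFormalSolution_truncated10 0 (by decide)
        (b := ![-1 / 2, -1 / 2,
          7643155718597 / 1769472000, 29645672092819 / 884736000]) (by decide +kernel)
    refine ⟨schemeWeights 3 2 (truncatedKernel 10), areTruncatedWeights_schemeWeights hK
      isFormalSolution_truncated10, ⟨1, one_pos, fun ε h _ _ _ => isCentral_centralWeights _ _⟩,
      hα3, hα2, hα1, hβ2, hβ1,
      hα3.flatLimit fun h => by ring,
      hα2.flatLimit fun h => by ring,
      hα1.flatLimit fun h => by ring,
      hβ2.flatLimit,
      hβ1.flatLimit,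
      hasLTE_schemeWeights hK isFormalSolution_truncated10 ![6 / 5, 6, 24, 72, 144, 144] (by decide +kernel)
        fun ε d => ?_⟩
    simp [Fin.sum_univ_succ, Nat.factorial]
    ring
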